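/- Let $n\ge 2$, $D\ge 1$, $K\ge 1$ be integers and let $a_1,\dots,a_K\in\mathbb R^D$ be Euclidean unit vectors. For a linear subspace $\mathcal B$ of $(\mathbb R^D)^{\otimes n}$ let $P_{\mathcal B}$ be the orthogonal projection onto $\mathcal B$ with respect to the Frobenius inner product, and put $F_{\mathcal B}(x)=\|P_{\mathcal B}(x^{\otimes n})\|_F^2$. Let $\mathcal A=\operatorname{Span}\{a_i^{\otimes n}: 1\le i\le K\}$, let $\rho_s=\sup_{\|x\|_2=1}\sum_{i=1}^K|\langle x,a_i\rangle|^s-1$, and set $$\tau=\tfrac16-n^2\rho_2-(n^2+n)\rho_n,\qquad \Delta_0=\frac{2\tau}{2+4\tau+3n^2}.$$ A second-order critical point of $F_{\mathcal B}$ is a point $x$ of the unit sphere $\mathbb S^{D-1}$ at which the Riemannian gradient of $F_{\mathcal B}|_{\mathbb S^{D-1}}$ vanishes and its Riemannian Hessian is negative semi-definite on the tangent space. (i) Let $\hat{\mathcal A}$ be a linear subspace of the space of symmetric tensors in $(\mathbb R^D)^{\otimes n}$, and let $\Delta_{\mathcal A}=\|P_{\mathcal A}-P_{\hat{\mathcal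 A}}\|_{F\to F}$ be the operator norm with respect to the Frobenius norm. If $\tau>0$ and $\Delta_{\mathcal A}<\Delta_0$, then there are exactly $2K$ second-order critical points $x$ of $F_{\hat{\mathcal A}}$ such that $$F_{\hat{\mathcal A}}(x)\ \ge\ \frac{2+2\tau+3n^2}{2\tau}\,\Delta_{\mathcal A}\quad\text{and}\quad F_{\hat{\mathcal A}}(x)>0$$ (the second condition matters only if $\Delta_{\mathcal A}=0$). Each of these points is a strict local maximizer of $F_{\hat{\mathcal A}}$ on $\mathbb S^{D-1}$, and for each such point $x^*$ there is a unique pair $(i,s)\in\{1,\dots,K\}\times\{-1,1\}$ with $\|x^*-s a_i\|_2^2\le 2\Delta_{\mathcal A}/n$. (ii) If $\tau\ge0$, then $F_{\mathcal A}$ (the noiseless case) has exactly $2K$ second-order critical points with positive value; they are the points $s a_i$ with $1\le i\le K$, $s\in\{-1,1\}$, and these are exactly the global maximizers of $F_{\mathcal A}$ on $\mathbb S^{D-1}$. -/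

import Mathlib

noncomputable section

/-- `ℝ^D` with the Euclidean norm. -/
abbrev Vec (D : ℕ) : Type := EuclideanSpace ℝ (Fin D)

/-- Real tensors of size `D × ⋯ × D` (`n` times) with the Frobenius inner product and norm. -/
abbrev Tens (D n : ℕ) : Type := EuclideanSpace ℝ (Fin n → Fin D)

/-- The tensor power `x^{⊗ n}`, with entries `x_{j_1} ⋯ x_{j_n}`. -/
def tensorPower {D : ℕ} (n : ℕ) (x : Vec D) : Tens D n :=
  WithLp.toLp 2 fun j => ∏ k, x (j k)

/-- The subspace of symmetric tensors: those unchanged by every permutation of the indices. -/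
def symTens (D n : ℕ) : Submodule ℝ (Tens D n) where
  carrier := {T | ∀ (σ : Equiv.Perm (Fin n)) (j : Fin n → Fin D), T (j ∘ σ) = T j}
  add_mem' := by
    intro S T hS hT σ j
    simp [hS σ j, hT σ j]
  zero_mem' := by
    intro σ j
    simp
  smul_mem' := by
    intro c T hT σ j
    simp [hT σ j]

/-- The span of `a_1^{⊗ n}, …, a_K^{⊗ n}`. -/
def powerSpan {D K : ℕ} (n : ℕ) (a : Fin K → Vec D) : Submodule ℝ (Tens D n) :=
  Submodule.span ℝ (Set.range fun i => tensorPower n (a i))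

/-- The objective `F_A(x) = ‖P_A(x^{⊗ n})‖_F ^ 2`, with `P_A` the orthogonal projection on `A`. -/
def spmObjective {D n : ℕ} (A : Submodule ℝ (Tens D n)) (x : Vec D) : ℝ :=
  ‖A.starProjection (tensorPower n x)‖ ^ 2

/-- The distance `‖P_A - P_B‖_{F → F}` of two subspaces (operator norm for the Frobenius norm). -/
def subspaceDist {D n : ℕ} (A B : Submodule ℝ (Tens D n)) : ℝ :=
  ‖A.starProjection - B.starProjection‖

/-- The frame constant `ρ_s = sup_{‖x‖ = 1} ∑ i, |⟨x, a_i⟩| ^ s - 1`. -/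
def frameConst {D K : ℕ} (a : Fin K → Vec D) (s : ℕ) : ℝ :=
  (⨆ x : Metric.sphere (0 : Vec D) 1, ∑ i, |inner ℝ (x : Vec D) (a i)| ^ s) - 1

/-- `τ = 1/6 - n² ρ_2 - (n² + n) ρ_n`. -/
def tauConst {D K : ℕ} (n : ℕ) (a : Fin K → Vec D) : ℝ :=
  1 / 6 - (n : ℝ) ^ 2 * frameConst a 2 - ((n : ℝ) ^ 2 + n) * frameConst a n

/-- The Riemannian gradient at a point `x` of the unit sphere of (the restriction of) `f`: the
tangential part `(I - x xᵀ) ∇f(x)` of the Euclidean gradient. -/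
def sphereGrad {D : ℕ} (f : Vec D → ℝ) (x : Vec D) : Vec D :=
  gradient f x - inner ℝ x (gradient f x) • x

/-- The quadratic form `zᵀ (∇²f(x) - (xᵀ∇f(x)) I) z` which, for `z` tangent to the unit sphere
at `x`, is the Riemannian Hessian of (the restriction of) `f`. The Euclidean Hessian is the
derivative of the Euclidean gradient. -/
def sphereHess {D : ℕ} (f : Vec D → ℝ) (x z : Vec D) : ℝ :=
  inner ℝ z (fderiv ℝ (gradient f) x z) - inner ℝ x (gradient f x) * inner ℝ z z

/-- `x` is a second-order critical point of the problem of maximizing `f` on the unit sphere: the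
Riemannian gradient vanishes and the Riemannian Hessian is negative semi-definite on the
tangent space. -/
def IsSecondOrderCritical {D : ℕ} (f : Vec D → ℝ) (x : Vec D) : Prop :=
  ‖x‖ = 1 ∧ sphereGrad f x = 0 ∧ ∀ z : Vec D, inner ℝ x z = 0 → sphereHess f x z ≤ 0

/-- `x` is a strict local maximizer of `f` on the unit sphere. -/
def IsStrictLocalMaxOnSphere {D : ℕ} (f : Vec D → ℝ) (x : Vec D) : Prop :=
  ‖x‖ = 1 ∧ ∃ ε > 0, ∀ y : Vec D, ‖y‖ = 1 → y ≠ x → dist y x < ε → f y < f x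

end

/-!
Write `A` for the span of the `a_i^{⊗ n}`, `B` for an arbitrary subspace, `Δ` for the distance of
the two projections, `F` for the objective of `B`, and `r`, `q` for the frame constants `ρ_2`,
`ρ_n`. The hypothesis on `τ` makes `n² r + (n² + n) q` at most `1/6`, and `Δ < Δ₀` makes `n² Δ` at
most `1/9`. The Gram matrix of the `a_i^{⊗ n}` is then diagonally dominant
(`exists_coeff_starProjection_powerSpan`, `mul_norm_sq_starProjection_powerSpan_le`), so `P_A`
behaves almost as if these tensors were orthonormal, and every quantity for `B` differs from the
one for `A` by a multiple of `Δ`.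

The argument works with the spherical caps `{x | capCos n ≤ ⟨x, ± a_i⟩}`, of squared sine
`1 / (3 n²)`, which are pairwise disjoint (`eq_of_mem_caps`).

* Every second-order critical point above the threshold lies in a cap
  (`IsSecondOrderCritical.exists_close`). One tests the second-order condition in the tangent
  direction `a_i - ⟨x, a_i⟩ x`, where `i` maximizes `|⟨x, a_i⟩|`.
* The Riemannian Hessian is negative definite on each cap (`sphereHess_neg_of_close`). As caps are
  geodesically convex, a critical point in a cap is the strict maximizer over the cap
  (`lt_of_sphereHess_neg_on_cap`), and there is at most one.
* The maximizer over a cap has value at least `F(± a_i) ≥ 1 - Δ²`, while the noiseless objective is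
  at most `1 - (9/16) n sin²θ` at angle `θ` from the center
  (`spmObjective_powerSpan_le_of_close`). Hence the maximizer is not on the boundary of the cap, so
  it is a second-order critical point, and it has distance at most `√(2 Δ / n)` from the center
  (`exists_critical_mem_cap`, `norm_sub_signedVec_sq_le`).

Part (ii) is the case `B = A`, `Δ = 0`, in which the last point identifies the maximizer over a cap
with its center.

The derivatives of the tensor power are written as sums over all slots, symmetric by construction,
so that the self-adjointness of the projection is all that enters the formulas for the gradient and
the Hessian.
-/

open scoped RealInnerProductSpace

/-! ### Derivatives of the tensor power and of the objective -/

/-- The elementary tensor `v_1 ⊗ ⋯ ⊗ v_n` as a continuous multilinear map of its factors. -/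
noncomputable def pureTensor (D n : ℕ) :
    ContinuousMultilinearMap ℝ (fun _ : Fin n => Vec D) (Tens D n) :=
  (EuclideanSpace.equiv (Fin n → Fin D) ℝ).symm.toContinuousLinearMap.compContinuousMultilinearMap
    (ContinuousMultilinearMap.pi fun j =>
      (ContinuousMultilinearMap.mkPiAlgebra ℝ (Fin n) ℝ).compContinuousLinearMap fun k =>
        EuclideanSpace.proj (j k))

lemma pureTensor_apply {D n : ℕ} (v : Fin n → Vec D) (j : Fin n → Fin D) :
    pureTensor D n v j = ∏ k, v k (j k) := by
  simp [pureTensor]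

lemma pureTensor_const {D : ℕ} (n : ℕ) (x : Vec D) :
    pureTensor D n (fun _ => x) = tensorPower n x := by
  ext j
  exact pureTensor_apply _ _

lemma inner_pureTensor {D n : ℕ} (v w : Fin n → Vec D) :
    ⟪pureTensor D n v, pureTensor D n w⟫ = ∏ k, ⟪v k, w k⟫ := by
  simp only [PiLp.inner_apply, pureTensor_apply, RCLike.inner_apply, conj_trivial]
  rw [Finset.prod_univ_sum, Fintype.piFinset_univ]
  exact Finset.sum_congr rfl fun j _ => by rw [← Finset.prod_mul_distrib]

lemma norm_pureTensor {D n : ℕ} (v : Fin n → Vec D) :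
    ‖pureTensor D n v‖ = ∏ k, ‖v k‖ := by
  have h := inner_pureTensor v v
  simp only [real_inner_self_eq_norm_sq] at h
  rw [Finset.prod_pow] at h
  exact (sq_eq_sq₀ (norm_nonneg _) (Finset.prod_nonneg fun _ _ => norm_nonneg _)).1 h

lemma inner_tensorPower {D n : ℕ} (x y : Vec D) :
    ⟪tensorPower n x, tensorPower n y⟫ = ⟪x, y⟫ ^ n := by
  rw [← pureTensor_const, ← pureTensor_const, inner_pureTensor]; simp

lemma norm_tensorPower {D n : ℕ} {x : Vec D} (hx : ‖x‖ = 1) : ‖tensorPower n x‖ = 1 := by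
  rw [← pureTensor_const, norm_pureTensor]; simp [hx]

/-- The derivative of the tensor power at `x` in the direction `y`: the sum over all slots of the
elementary tensor with `y` in that slot and `x` in the others. -/
noncomputable def tensorPowerDeriv {D : ℕ} (n : ℕ) (x y : Vec D) : Tens D n :=
  ∑ k, pureTensor D n (Function.update (fun _ => x) k y)

/-- The second derivative of the tensor power at `x` in the directions `y` and `z`: the sum over
all ordered pairs of distinct slots of the elementary tensor with `y` and `z` in these slots and
`x` in the others. -/
noncomputable def tensorPowerDeriv₂ {D : ℕ} (n : ℕ) (x y z : Vec D) : Tens D n :=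
  ∑ k, ∑ l ∈ Finset.univ.erase k,
    pureTensor D n (Function.update (Function.update (fun _ => x) k y) l z)

section Algebra

variable {D n : ℕ} (x y z u : Vec D)

lemma tensorPowerDeriv_self : tensorPowerDeriv n x x = (n : ℝ) • tensorPower n x := by
  simp [tensorPowerDeriv, pureTensor_const, Nat.cast_smul_eq_nsmul]

lemma tensorPowerDeriv_sub_smul (c : ℝ) :
    tensorPowerDeriv n x (y - c • z) = tensorPowerDeriv n x y - c • tensorPowerDeriv n x z := by
  simp [tensorPowerDeriv, ContinuousMultilinearMap.map_update_sub, Finset.smul_sum]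

lemma tensorPowerDeriv₂_sub_smul_right (c : ℝ) :
    tensorPowerDeriv₂ n x u (y - c • z)
      = tensorPowerDeriv₂ n x u y - c • tensorPowerDeriv₂ n x u z := by
  simp only [tensorPowerDeriv₂, ContinuousMultilinearMap.map_update_sub,
    ContinuousMultilinearMap.map_update_smul, Finset.smul_sum, Finset.sum_sub_distrib]

lemma tensorPowerDeriv₂_comm :
    tensorPowerDeriv₂ n x y z = tensorPowerDeriv₂ n x z y := by
  unfold tensorPowerDeriv₂
  rw [Finset.sum_comm' (t' := Finset.univ) (s' := fun l => Finset.univ.erase l)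
    (by intro a b; simp [ne_comm])]
  refine Finset.sum_congr rfl fun k _ => Finset.sum_congr rfl fun l hl => ?_
  rw [Function.update_comm (Finset.ne_of_mem_erase hl)]

lemma tensorPowerDeriv₂_self_right :
    tensorPowerDeriv₂ n x y x = ((n : ℝ) - 1) • tensorPowerDeriv n x y := by
  unfold tensorPowerDeriv₂ tensorPowerDeriv
  rw [Finset.smul_sum]
  refine Finset.sum_congr rfl fun k _ => ?_
  have h : ∀ l ∈ Finset.univ.erase k,
      pureTensor D n (Function.update (Function.update (fun _ => x) k y) l x)
        = pureTensor D n (Function.update (fun _ => x) k y) := by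
    intro l hl
    congr 1
    rw [Function.update_eq_iff]
    simp [Function.update_of_ne (Finset.ne_of_mem_erase hl)]
  rw [Finset.sum_congr rfl h, Finset.sum_const, Finset.card_erase_of_mem (Finset.mem_univ _),
    Finset.card_univ, Fintype.card_fin, ← Nat.cast_smul_eq_nsmul ℝ, Nat.cast_pred k.pos]

lemma inner_tensorPower_deriv :
    ⟪tensorPower n u, tensorPowerDeriv n x y⟫ = n * (⟪u, x⟫ ^ (n - 1) * ⟪u, y⟫) := by
  unfold tensorPowerDeriv
  rw [inner_sum, ← pureTensor_const]
  have h : ∀ k : Fin n, ⟪pureTensor D n (fun _ => u),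
      pureTensor D n (Function.update (fun _ => x) k y)⟫ = ⟪u, x⟫ ^ (n - 1) * ⟪u, y⟫ := by
    intro k
    rw [inner_pureTensor, ← Finset.mul_prod_erase Finset.univ _ (Finset.mem_univ k),
      Function.update_self, mul_comm]
    congr 1
    rw [Finset.prod_congr rfl fun l hl => by
      rw [Function.update_of_ne (Finset.ne_of_mem_erase hl)], Finset.prod_const]
    simp
  simp [h]

lemma inner_tensorPower_deriv₂ :
    ⟪tensorPower n u, tensorPowerDeriv₂ n x y z⟫
      = n * ((n - 1) * (⟪u, x⟫ ^ (n - 2) * (⟪u, y⟫ * ⟪u, z⟫))) := by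
  unfold tensorPowerDeriv₂
  simp only [inner_sum]
  rw [← pureTensor_const]
  have h : ∀ k : Fin n, ∀ l ∈ Finset.univ.erase k, ⟪pureTensor D n (fun _ => u),
      pureTensor D n (Function.update (Function.update (fun _ => x) k y) l z)⟫
        = ⟪u, x⟫ ^ (n - 2) * (⟪u, y⟫ * ⟪u, z⟫) := by
    intro k l hl
    have hlk := Finset.ne_of_mem_erase hl
    rw [inner_pureTensor, ← Finset.mul_prod_erase Finset.univ _ (Finset.mem_univ k),
      ← Finset.mul_prod_erase (Finset.univ.erase k) _ hl, Function.update_self,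
      Function.update_of_ne hlk.symm, Function.update_self, ← mul_assoc, mul_comm]
    congr 1
    rw [Finset.prod_congr rfl fun m hm => by
      rw [Function.update_of_ne (Finset.ne_of_mem_erase hm),
        Function.update_of_ne (Finset.ne_of_mem_erase (Finset.mem_of_mem_erase hm))],
      Finset.prod_const, Finset.card_erase_of_mem hl]
    simp [Nat.sub_sub]
  rw [Finset.sum_congr rfl fun k _ => Finset.sum_congr rfl (h k)]
  have h' : ∀ k : Fin n, (((Finset.univ.erase k).card : ℕ) : ℝ) = n - 1 := by
    intro k
    rw [Finset.card_erase_of_mem (Finset.mem_univ _), Finset.card_univ, Fintype.card_fin,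
      Nat.cast_pred k.pos]
  simp only [Finset.sum_const, nsmul_eq_mul, h', Finset.card_univ, Fintype.card_fin]

lemma norm_tensorPowerDeriv_le (hx : ‖x‖ = 1) : ‖tensorPowerDeriv n x y‖ ≤ n * ‖y‖ := by
  refine (norm_sum_le _ _).trans ?_
  have h : ∀ k : Fin n, ‖pureTensor D n (Function.update (fun _ => x) k y)‖ = ‖y‖ := by
    intro k
    rw [norm_pureTensor, ← Finset.mul_prod_erase Finset.univ _ (Finset.mem_univ k),
      Function.update_self, Finset.prod_congr rfl fun l hl => by
      rw [Function.update_of_ne (Finset.ne_of_mem_erase hl), hx]]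
    simp
  simp [h]

lemma norm_tensorPowerDeriv₂_le (hx : ‖x‖ = 1) :
    ‖tensorPowerDeriv₂ n x y z‖ ≤ n * ((n - 1) * (‖y‖ * ‖z‖)) := by
  have h : ∀ k : Fin n, ∀ l ∈ Finset.univ.erase k,
      ‖pureTensor D n (Function.update (Function.update (fun _ => x) k y) l z)‖
        = ‖y‖ * ‖z‖ := by
    intro k l hl
    have hlk := Finset.ne_of_mem_erase hl
    rw [norm_pureTensor, ← Finset.mul_prod_erase Finset.univ _ (Finset.mem_univ k),
      ← Finset.mul_prod_erase (Finset.univ.erase k) _ hl, Function.update_self,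
      Function.update_of_ne hlk.symm, Function.update_self, Finset.prod_congr rfl fun m hm => by
      rw [Function.update_of_ne (Finset.ne_of_mem_erase hm),
        Function.update_of_ne (Finset.ne_of_mem_erase (Finset.mem_of_mem_erase hm)), hx]]
    simp
  have h' : ∀ k : Fin n, (((Finset.univ.erase k).card : ℕ) : ℝ) = n - 1 := by
    intro k
    rw [Finset.card_erase_of_mem (Finset.mem_univ _), Finset.card_univ, Fintype.card_fin,
      Nat.cast_pred k.pos]
  unfold tensorPowerDeriv₂
  refine (norm_sum_le _ _).trans ((Finset.sum_le_sum fun k _ => norm_sum_le _ _).trans ?_)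
  rw [Finset.sum_congr rfl fun k _ => Finset.sum_congr rfl (h k)]
  simp only [Finset.sum_const, nsmul_eq_mul, h', Finset.card_univ, Fintype.card_fin, le_refl]

end Algebra

section Calculus

variable {D n : ℕ}

lemma contDiff_tensorPower : ContDiff ℝ 2 (tensorPower n : Vec D → Tens D n) := by
  have h : (tensorPower n : Vec D → Tens D n)
      = pureTensor D n ∘ fun x : Vec D => (fun _ : Fin n => x) :=
    funext fun x => (pureTensor_const n x).symm
  rw [h]
  exact (pureTensor D n).contDiff.comp (by fun_prop)

lemma hasFDerivAt_tensorPower (x : Vec D) :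
    ∃ L : Vec D →L[ℝ] Tens D n, HasFDerivAt (tensorPower n) L x ∧
      ∀ y, L y = tensorPowerDeriv n x y := by
  have h1 := (pureTensor D n).hasFDerivAt (fun _ => x)
  have h2 : HasFDerivAt (fun x : Vec D => (fun _ : Fin n => x))
      (ContinuousLinearMap.pi fun _ => ContinuousLinearMap.id ℝ (Vec D)) x :=
    hasFDerivAt_pi.2 fun _ => hasFDerivAt_id x
  have h : (tensorPower n : Vec D → Tens D n)
      = pureTensor D n ∘ fun x : Vec D => (fun _ : Fin n => x) :=
    funext fun x => (pureTensor_const n x).symm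
  refine ⟨_, h ▸ h1.comp x h2, fun y => ?_⟩
  simp [tensorPowerDeriv, ContinuousMultilinearMap.linearDeriv_apply]

lemma hasFDerivAt_tensorPowerDeriv (x y : Vec D) :
    ∃ L : Vec D →L[ℝ] Tens D n, HasFDerivAt (fun x => tensorPowerDeriv n x y) L x ∧
      ∀ z, L z = tensorPowerDeriv₂ n x y z := by
  have h (k : Fin n) : ∃ L : Vec D →L[ℝ] Tens D n,
      HasFDerivAt (fun x => pureTensor D n (Function.update (fun _ => x) k y)) L x ∧
      ∀ z, L z = ∑ l ∈ Finset.univ.erase k,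
        pureTensor D n (Function.update (Function.update (fun _ => x) k y) l z) := by
    have h1 := (pureTensor D n).hasFDerivAt (Function.update (fun _ => x) k y)
    have h2 : HasFDerivAt (fun x : Vec D => Function.update (fun _ : Fin n => x) k y)
        (ContinuousLinearMap.pi fun l =>
          if l = k then 0 else ContinuousLinearMap.id ℝ (Vec D)) x := by
      refine hasFDerivAt_pi.2 fun l => ?_
      by_cases hl : l = k
      · subst hl; simpa using hasFDerivAt_const y x
      · simp only [Function.update_of_ne hl, if_neg hl]
        exact hasFDerivAt_id x
    refine ⟨_, h1.comp x h2, fun z => ?_⟩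
    simp only [ContinuousLinearMap.comp_apply, ContinuousMultilinearMap.linearDeriv_apply]
    rw [← Finset.add_sum_erase Finset.univ _ (Finset.mem_univ k)]
    rw [ContinuousMultilinearMap.map_coord_zero _ k (by simp), zero_add]
    refine Finset.sum_congr rfl fun l hl => ?_
    simp [Finset.ne_of_mem_erase hl]
  choose L hL hL' using h
  refine ⟨∑ k, L k, HasFDerivAt.fun_sum fun k _ => hL k, fun z => ?_⟩
  simp [tensorPowerDeriv₂, hL']

end Calculus

section Objective

variable {D n : ℕ} (B : Submodule ℝ (Tens D n))

lemma inner_starProjection_comm (S T : Tens D n) :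
    ⟪B.starProjection S, T⟫ = ⟪S, B.starProjection T⟫ :=
  B.inner_starProjection_left_eq_right S T

lemma inner_starProjection_self (T : Tens D n) :
    ⟪B.starProjection T, T⟫ = ‖B.starProjection T‖ ^ 2 := by
  rw [← real_inner_self_eq_norm_sq, ← inner_starProjection_comm,
    B.starProjection_eq_self_iff.2 (B.starProjection_apply_mem T)]

lemma contDiff_spmObjective : ContDiff ℝ 2 (spmObjective B) :=
  (B.starProjection.contDiff.comp contDiff_tensorPower).norm_sq ℝ

lemma inner_gradient_spmObjective (x y : Vec D) :
    ⟪gradient (spmObjective B) x, y⟫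
      = 2 * ⟪B.starProjection (tensorPower n x), tensorPowerDeriv n x y⟫ := by
  obtain ⟨L, hL, hL'⟩ := hasFDerivAt_tensorPower (n := n) x
  have h' : fderiv ℝ (spmObjective B) x = _ :=
    (B.starProjection.hasFDerivAt.comp x hL).norm_sq.fderiv
  rw [gradient, InnerProductSpace.toDual_symm_apply, h']
  simp only [two_smul, add_apply, ContinuousLinearMap.comp_apply,
    innerSL_apply_apply, hL', Function.comp]
  rw [← inner_starProjection_comm, B.starProjection_eq_self_iff.2 (B.starProjection_apply_mem _)]
  ring

lemma differentiable_gradient {f : Vec D → ℝ} (hf : ContDiff ℝ 2 f) :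
    Differentiable ℝ (gradient f) :=
  (InnerProductSpace.toDual ℝ (Vec D)).symm.toContinuousLinearEquiv.differentiable.comp
    ((hf.fderiv_right (m := 1) (by norm_num)).differentiable (by norm_num))

lemma inner_fderiv_gradient_spmObjective (x z : Vec D) :
    ⟪z, fderiv ℝ (gradient (spmObjective B)) x z⟫
      = 2 * ‖B.starProjection (tensorPowerDeriv n x z)‖ ^ 2
        + 2 * ⟪B.starProjection (tensorPower n x), tensorPowerDeriv₂ n x z z⟫ := by
  obtain ⟨L, hL, hL'⟩ := hasFDerivAt_tensorPower (n := n) x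
  obtain ⟨M, hM, hM'⟩ := hasFDerivAt_tensorPowerDeriv (n := n) x z
  have h1 := ((hasFDerivAt_const z x).inner ℝ
    (differentiable_gradient (contDiff_spmObjective B) x).hasFDerivAt)
  have h2 := ((B.starProjection.hasFDerivAt.comp x hL).inner ℝ hM).const_mul 2
  have h3 : (fun y => ⟪z, gradient (spmObjective B) y⟫)
      = fun y => 2 * ⟪(B.starProjection ∘ tensorPower n) y, tensorPowerDeriv n y z⟫ := by
    funext y
    rw [real_inner_comm, inner_gradient_spmObjective]
    rfl
  rw [h3] at h1
  have h4 := DFunLike.congr_fun (h1.unique h2) z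
  simp [fderivInnerCLM_apply, hL', hM'] at h4
  rw [h4, ← inner_starProjection_self]
  ring

end Objective

/-! ### Great circles, second-order conditions and caps on the sphere -/

section Sphere

variable {D : ℕ} {f : Vec D → ℝ} {x z : Vec D}

/-- The great circle through `x` with initial velocity `z`. -/
noncomputable def greatCircle (x z : Vec D) (t : ℝ) : Vec D := Real.cos t • x + Real.sin t • z

@[simp] lemma greatCircle_zero : greatCircle x z 0 = x := by simp [greatCircle]

lemma hasDerivAt_greatCircle (x z : Vec D) (t : ℝ) :
    HasDerivAt (greatCircle x z) (greatCircle z (-x) t) t := by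
  have h := ((Real.hasDerivAt_cos t).smul_const x).add ((Real.hasDerivAt_sin t).smul_const z)
  refine h.congr_deriv ?_
  simp [greatCircle, add_comm]

lemma greatCircle_unit_speed (hx : ‖x‖ = 1) (hz : ‖z‖ = 1) (hxz : ⟪x, z⟫ = 0) (t : ℝ) :
    ‖greatCircle x z t‖ = 1 ∧ ‖greatCircle z (-x) t‖ = 1 ∧
      ⟪greatCircle x z t, greatCircle z (-x) t⟫ = 0 := by
  have hzx : ⟪z, x⟫ = 0 := by rw [real_inner_comm, hxz]
  have hxx : ⟪x, x⟫ = 1 := by rw [real_inner_self_eq_norm_sq, hx]; norm_num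
  have hzz : ⟪z, z⟫ = 1 := by rw [real_inner_self_eq_norm_sq, hz]; norm_num
  have key : ∀ v : Vec D, ⟪v, v⟫ = 1 → ‖v‖ = 1 := fun v hv => by
    rw [real_inner_self_eq_norm_sq] at hv
    exact (pow_eq_one_iff_of_nonneg (norm_nonneg v) two_ne_zero).1 hv
  refine ⟨key _ ?_, key _ ?_, ?_⟩ <;>
  · simp only [greatCircle, inner_add_left, inner_add_right, real_inner_smul_left,
      real_inner_smul_right, inner_neg_left, inner_neg_right, hxx, hzz, hxz, hzx]
    nlinarith [Real.sin_sq_add_cos_sq t]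

lemma hasDerivAt_comp_greatCircle (hf : ContDiff ℝ 2 f) (x z : Vec D) (t : ℝ) :
    HasDerivAt (fun t => f (greatCircle x z t))
      ⟪gradient f (greatCircle x z t), greatCircle z (-x) t⟫ t := by
  have h := ((hf.differentiable (by norm_num) (greatCircle x z t)).hasFDerivAt).comp_hasDerivAt t
    (hasDerivAt_greatCircle x z t)
  rwa [← InnerProductSpace.toDual_symm_apply] at h

/-- The second derivative of `f` along a unit speed great circle is the Riemannian Hessian. -/
lemma hasDerivAt_deriv_comp_greatCircle (hf : ContDiff ℝ 2 f)
    (hx : ‖x‖ = 1) (hz : ‖z‖ = 1) (hxz : ⟪x, z⟫ = 0) (t : ℝ) :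
    HasDerivAt (fun t => ⟪gradient f (greatCircle x z t), greatCircle z (-x) t⟫)
      (sphereHess f (greatCircle x z t) (greatCircle z (-x) t)) t := by
  have h := ((differentiable_gradient hf (greatCircle x z t)).hasFDerivAt).comp_hasDerivAt t
    (hasDerivAt_greatCircle x z t)
  have h' := h.inner ℝ (hasDerivAt_greatCircle z (-x) t)
  refine h'.congr_deriv ?_
  have e : greatCircle (-x) (-z) t = - greatCircle x z t := by simp [greatCircle, add_comm]
  have e1 : ⟪greatCircle z (-x) t, greatCircle z (-x) t⟫ = 1 := by
    rw [real_inner_self_eq_norm_sq, (greatCircle_unit_speed hx hz hxz t).2.1]; norm_num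
  rw [e, sphereHess, e1, inner_neg_right, real_inner_comm _ (greatCircle x z t),
    real_inner_comm (greatCircle z (-x) t)]
  simp only [Function.comp]
  ring

lemma sphereHess_smul (c : ℝ) : sphereHess f x (c • z) = c ^ 2 * sphereHess f x z := by
  simp only [sphereHess, map_smul, real_inner_smul_left, real_inner_smul_right]
  ring

/-- The second-order necessary conditions at a local maximizer on the sphere. -/
lemma isSecondOrderCritical_of_isLocalMax (hf : ContDiff ℝ 2 f) (hx : ‖x‖ = 1) {ε : ℝ}
    (hε : 0 < ε) (hmax : ∀ y, ‖y‖ = 1 → dist y x < ε → f y ≤ f x) :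
    IsSecondOrderCritical f x := by
  have key : ∀ z : Vec D, ‖z‖ = 1 → ⟪x, z⟫ = 0 →
      ⟪gradient f x, z⟫ = 0 ∧ sphereHess f x z ≤ 0 := by
    intro z hz hxz
    set φ : ℝ → ℝ := fun t => f (greatCircle x z t) with hφ
    have hloc : IsLocalMax φ 0 := by
      have hc : ContinuousAt (greatCircle x z) 0 := (hasDerivAt_greatCircle x z 0).continuousAt
      have := hc.eventually (Metric.ball_mem_nhds (greatCircle x z 0) hε)
      filter_upwards [this] with t ht
      rw [greatCircle_zero] at ht
      simpa [hφ] using hmax _ (greatCircle_unit_speed hx hz hxz t).1 ht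
    have hd1 : deriv φ = fun t => ⟪gradient f (greatCircle x z t), greatCircle z (-x) t⟫ :=
      funext fun t => (hasDerivAt_comp_greatCircle hf x z t).deriv
    have hd2 := hasDerivAt_deriv_comp_greatCircle hf hx hz hxz 0
    rw [← hd1] at hd2
    simp only [greatCircle_zero] at hd2
    have h0 : deriv φ 0 = 0 := hloc.deriv_eq_zero
    refine ⟨by simpa [hd1] using h0, ?_⟩
    by_contra! hpos
    have hmin : IsLocalMin φ 0 := isLocalMin_of_deriv_deriv_pos (by rwa [hd2.deriv]) h0
      (hasDerivAt_comp_greatCircle hf x z 0).continuousAt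
    -- A point that is both a local maximum and a local minimum has `φ` constant around it.
    have hconst : φ =ᶠ[nhds 0] fun _ => φ 0 := by
      filter_upwards [hloc, hmin] with t h1 h2 using le_antisymm h1 h2
    have : deriv (deriv φ) 0 = 0 := by
      rw [hconst.deriv.deriv_eq]; simp
    rw [hd2.deriv] at this
    exact hpos.ne' this
  have key2 : ∀ z : Vec D, ⟪x, z⟫ = 0 → ⟪gradient f x, z⟫ = 0 ∧ sphereHess f x z ≤ 0 := by
    intro z hxz
    rcases eq_or_ne z 0 with rfl | hz
    · simp [sphereHess]
    · obtain ⟨h1, h2⟩ := key (‖z‖⁻¹ • z) (norm_smul_inv_norm (𝕜 := ℝ) hz)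
        (by rw [real_inner_smul_right, hxz, mul_zero])
      have hz' : (0 : ℝ) < ‖z‖⁻¹ := inv_pos.2 (norm_pos_iff.2 hz)
      rw [real_inner_smul_right] at h1
      rw [sphereHess_smul] at h2
      exact ⟨(mul_eq_zero.1 h1).resolve_left hz'.ne', by
        by_contra! h; exact absurd h2 (not_le.2 (by positivity))⟩
  refine ⟨hx, ?_, fun z hz => (key2 z hz).2⟩
  have horth : ⟪x, sphereGrad f x⟫ = 0 := by
    simp [sphereGrad, inner_sub_right, real_inner_smul_right, hx]
  rw [← inner_self_eq_zero (𝕜 := ℝ)]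
  nth_rewrite 1 [sphereGrad]
  rw [inner_sub_left, real_inner_smul_left, (key2 _ horth).1, horth]
  ring

/-- If the Riemannian Hessian is negative definite on a spherical cap inside an open hemisphere,
then a critical point in the cap is the strict maximizer over the cap: caps are geodesically
convex, and `f` is strictly concave along each geodesic of the cap. -/
lemma lt_of_sphereHess_neg_on_cap (hf : ContDiff ℝ 2 f) {a : Vec D} {κ : ℝ} (hκ : 0 < κ)
    (hH : ∀ y : Vec D, ‖y‖ = 1 → κ ≤ ⟪y, a⟫ → ∀ z : Vec D, ‖z‖ = 1 → ⟪y, z⟫ = 0 →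
      sphereHess f y z < 0)
    (hx : ‖x‖ = 1) (hxa : κ ≤ ⟪x, a⟫) (hgrad : sphereGrad f x = 0)
    {y : Vec D} (hy : ‖y‖ = 1) (hya : κ ≤ ⟪y, a⟫) (hne : y ≠ x) : f y < f x := by
  set c : ℝ := ⟪x, y⟫ with hc
  have hc1 : c < 1 := by
    refine lt_of_le_of_ne ?_ fun h => hne ((inner_eq_one_iff_of_norm_eq_one hx hy).1 h).symm
    simpa [hx, hy] using real_inner_le_norm x y
  have hc2 : -1 < c := by
    refine lt_of_le_of_ne ?_ fun h => ?_
    · have := neg_le_of_abs_le (abs_real_inner_le_norm x y)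
      simpa [hx, hy] using this
    · have h1 : ⟪x, -y⟫ = 1 := by rw [inner_neg_right, ← hc, ← h]; norm_num
      have h2 := (inner_eq_one_iff_of_norm_eq_one hx (by rwa [norm_neg])).1 h1
      rw [h2, inner_neg_left] at hxa
      linarith
  set T := Real.arccos c with hT
  have hcosT : Real.cos T = c := Real.cos_arccos hc2.le hc1.le
  have hT0 : 0 < T := Real.arccos_pos.2 hc1
  have hTπ : T < Real.pi := by
    refine lt_of_le_of_ne (Real.arccos_le_pi c) fun h => ?_
    exact absurd (Real.arccos_eq_pi.1 h) (not_le.2 hc2)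
  have hsin : 0 < Real.sin T := Real.sin_pos_of_pos_of_lt_pi hT0 hTπ
  set z : Vec D := (Real.sin T)⁻¹ • (y - c • x) with hzdef
  have hxz : ⟪x, z⟫ = 0 := by
    simp [hzdef, real_inner_smul_right, inner_sub_right, ← hc, hx]
  have hyx : ⟪y, x⟫ = c := by rw [real_inner_comm]
  have hz : ‖z‖ = 1 := by
    have h1 : ‖y - c • x‖ ^ 2 = Real.sin T ^ 2 := by
      rw [← real_inner_self_eq_norm_sq, Real.sin_sq, hcosT]
      simp only [inner_sub_left, inner_sub_right, real_inner_smul_left, real_inner_smul_right,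
        ← hc, hyx]
      rw [real_inner_self_eq_norm_sq, real_inner_self_eq_norm_sq, hx, hy]
      ring
    have h2 : ‖y - c • x‖ = Real.sin T := by
      exact (sq_eq_sq₀ (norm_nonneg _) hsin.le).1 h1
    rw [hzdef, norm_smul, h2, norm_inv, Real.norm_of_nonneg hsin.le, inv_mul_cancel₀ hsin.ne']
  have hγT : greatCircle x z T = y := by
    simp only [greatCircle, hzdef, hcosT, smul_smul, mul_inv_cancel₀ hsin.ne', one_smul]
    abel
  have hcap : ∀ t ∈ Set.Ioo 0 T, κ ≤ ⟪greatCircle x z t, a⟫ := by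
    intro t ht
    have h1 : 0 < Real.sin t := Real.sin_pos_of_pos_of_lt_pi ht.1 (ht.2.trans hTπ)
    have h2 : 0 < Real.sin (T - t) :=
      Real.sin_pos_of_pos_of_lt_pi (by linarith [ht.2]) (by linarith [ht.1])
    have h3 : Real.sin T ≤ Real.sin (T - t) + Real.sin t := by
      have h : Real.sin T = Real.sin (T - t) * Real.cos t + Real.cos (T - t) * Real.sin t := by
        rw [← Real.sin_add]; ring_nf
      rw [h]
      nlinarith [Real.cos_le_one t, Real.cos_le_one (T - t)]
    have h4 : Real.sin T * ⟪greatCircle x z t, a⟫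
        = Real.sin (T - t) * ⟪x, a⟫ + Real.sin t * ⟪y, a⟫ := by
      simp only [greatCircle, hzdef, inner_add_left, real_inner_smul_left, inner_sub_left,
        Real.sin_sub, hcosT]
      field_simp
      ring
    nlinarith
  set φ : ℝ → ℝ := fun t => f (greatCircle x z t) with hφ
  have hd1 : deriv φ = fun t => ⟪gradient f (greatCircle x z t), greatCircle z (-x) t⟫ :=
    funext fun t => (hasDerivAt_comp_greatCircle hf x z t).deriv
  have hd2 : ∀ t, HasDerivAt (deriv φ)
      (sphereHess f (greatCircle x z t) (greatCircle z (-x) t)) t :=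
    fun t => hd1 ▸ hasDerivAt_deriv_comp_greatCircle hf hx hz hxz t
  have h0 : deriv φ 0 = 0 := by
    rw [hd1]
    simp only [greatCircle_zero]
    have : ⟪sphereGrad f x, z⟫ = 0 := by rw [hgrad, inner_zero_left]
    rwa [sphereGrad, inner_sub_left, real_inner_smul_left, hxz, mul_zero, sub_zero] at this
  have hanti : StrictAntiOn (deriv φ) (Set.Icc 0 T) := by
    refine strictAntiOn_of_deriv_neg (convex_Icc 0 T)
      (fun t _ => (hd2 t).continuousAt.continuousWithinAt) fun t ht => ?_
    rw [interior_Icc] at ht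
    rw [(hd2 t).deriv]
    obtain ⟨h1, h2, h3⟩ := greatCircle_unit_speed hx hz hxz t
    exact hH _ h1 (hcap t ht) _ h2 h3
  have hanti' : StrictAntiOn φ (Set.Icc 0 T) := by
    refine strictAntiOn_of_deriv_neg (convex_Icc 0 T)
      (fun t _ => (hasDerivAt_comp_greatCircle hf x z t).continuousAt.continuousWithinAt)
      fun t ht => ?_
    rw [interior_Icc] at ht
    rw [← h0]
    exact hanti (Set.left_mem_Icc.2 hT0.le) (Set.Ioo_subset_Icc_self ht) ht.1
  have := hanti' (Set.left_mem_Icc.2 hT0.le) (Set.right_mem_Icc.2 hT0.le) hT0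
  simpa [hφ, hγT] using this

end Sphere

/-! ### Frame bounds for the tensors `a_i^{⊗ n}` -/

section Frame

variable {D K n : ℕ} {a : Fin K → Vec D}

lemma bddAbove_sum_abs_inner_pow (ha : ∀ i, ‖a i‖ = 1) (s : ℕ) :
    BddAbove (Set.range fun x : Metric.sphere (0 : Vec D) 1 =>
      ∑ i, |⟪(x : Vec D), a i⟫| ^ s) := by
  refine ⟨K, ?_⟩
  rintro _ ⟨x, rfl⟩
  have hx : ‖(x : Vec D)‖ = 1 := by simp
  have : ∀ i ∈ Finset.univ, |⟪(x : Vec D), a i⟫| ^ s ≤ 1 := fun i _ =>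
    pow_le_one₀ (abs_nonneg _) (by simpa [hx, ha i] using abs_real_inner_le_norm (x : Vec D) (a i))
  simpa using Finset.sum_le_sum this

lemma sum_abs_inner_pow_le (ha : ∀ i, ‖a i‖ = 1) (s : ℕ) {x : Vec D} (hx : ‖x‖ = 1) :
    ∑ i, |⟪x, a i⟫| ^ s ≤ 1 + frameConst a s := by
  have := le_ciSup (bddAbove_sum_abs_inner_pow ha s) ⟨x, by simpa using hx⟩
  unfold frameConst
  linarith

lemma sum_erase_abs_inner_pow_le (ha : ∀ i, ‖a i‖ = 1) (s : ℕ) (i : Fin K) :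
    ∑ j ∈ Finset.univ.erase i, |⟪a i, a j⟫| ^ s ≤ frameConst a s := by
  have h := sum_abs_inner_pow_le ha s (ha i)
  rw [← Finset.add_sum_erase _ _ (Finset.mem_univ i), real_inner_self_eq_norm_sq, ha i] at h
  simp only [one_pow, abs_one] at h
  linarith

lemma frameConst_nonneg (ha : ∀ i, ‖a i‖ = 1) (s : ℕ) (i : Fin K) : 0 ≤ frameConst a s :=
  (Finset.sum_nonneg fun _ _ => by positivity).trans (sum_erase_abs_inner_pow_le ha s i)

lemma sum_inner_sq_le (ha : ∀ i, ‖a i‖ = 1) (x : Vec D) :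
    ∑ i, ⟪x, a i⟫ ^ 2 ≤ (1 + frameConst a 2) * ‖x‖ ^ 2 := by
  rcases eq_or_ne x 0 with rfl | hx
  · simp
  · have h := sum_abs_inner_pow_le ha 2 (norm_smul_inv_norm (𝕜 := ℝ) hx)
    have hx' := norm_pos_iff.2 hx
    simp only [sq_abs, real_inner_smul_left, mul_pow, ← Finset.mul_sum, RCLike.ofReal_real_eq_id,
      id, inv_pow] at h
    rwa [inv_mul_le_iff₀ (by positivity), mul_comm] at h

variable {q : ℝ}

/-- The Gram matrix of the tensors `a_i^{⊗ n}` is diagonally dominant, so that the coefficients of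
a projection onto their span are close, entrywise, to the inner products with these tensors. -/
lemma exists_coeff_starProjection_powerSpan (ha : ∀ i, ‖a i‖ = 1)
    (hq : ∀ i, ∑ j ∈ Finset.univ.erase i, |⟪a i, a j⟫| ^ n ≤ q) (T : Tens D n) {V : ℝ}
    (hV : ∀ i, |⟪tensorPower n (a i), T⟫| ≤ V) :
    ∃ σ : Fin K → ℝ, (powerSpan n a).starProjection T = ∑ j, σ j • tensorPower n (a j) ∧
      (∀ i, (1 - q) * |σ i| ≤ V) ∧
      ∀ i, (1 - q) * |σ i - ⟪tensorPower n (a i), T⟫| ≤ q * V := by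
  obtain ⟨σ, hσ⟩ := Submodule.mem_span_range_iff_exists_fun ℝ |>.1
    ((powerSpan n a).starProjection_apply_mem T)
  rcases isEmpty_or_nonempty (Fin K) with hK | hK
  · exact ⟨σ, hσ.symm, fun i => hK.elim i, fun i => hK.elim i⟩
  have hinner : ∀ i, ⟪tensorPower n (a i), T⟫
      = σ i + ∑ j ∈ Finset.univ.erase i, σ j * ⟪a i, a j⟫ ^ n := by
    intro i
    have hi : (powerSpan n a).starProjection (tensorPower n (a i)) = tensorPower n (a i) :=
      (powerSpan n a).starProjection_eq_self_iff.2 (Submodule.subset_span ⟨i, rfl⟩)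
    rw [← hi, inner_starProjection_comm, ← hσ, inner_sum,
      ← Finset.add_sum_erase _ _ (Finset.mem_univ i)]
    simp only [real_inner_smul_right, real_inner_self_eq_norm_sq, norm_tensorPower (ha i)]
    simp only [inner_tensorPower]
    norm_num
  obtain ⟨m, -, hm⟩ := Finset.exists_max_image Finset.univ (fun i => |σ i|) Finset.univ_nonempty
  have hoff : ∀ i, |σ i - ⟪tensorPower n (a i), T⟫| ≤ q * |σ m| := by
    intro i
    rw [hinner i, sub_add_cancel_left, abs_neg]
    refine (Finset.abs_sum_le_sum_abs _ _).trans ?_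
    calc ∑ j ∈ Finset.univ.erase i, |σ j * ⟪a i, a j⟫ ^ n|
        ≤ ∑ j ∈ Finset.univ.erase i, |⟪a i, a j⟫| ^ n * |σ m| := by
          refine Finset.sum_le_sum fun j _ => ?_
          rw [abs_mul, abs_pow, mul_comm]
          exact mul_le_mul_of_nonneg_left (hm j (Finset.mem_univ j)) (by positivity)
      _ ≤ q * |σ m| := by
          rw [← Finset.sum_mul]
          exact mul_le_mul_of_nonneg_right (hq i) (abs_nonneg _)
  have hmV : (1 - q) * |σ m| ≤ V := by
    have h1 := hoff m
    have h2 := abs_sub_abs_le_abs_sub (σ m) ⟪tensorPower n (a m), T⟫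
    linarith [hV m]
  have hq0 : 0 ≤ q := (Finset.sum_nonneg fun _ _ => by positivity).trans (hq m)
  refine ⟨σ, hσ.symm, fun i => ?_, fun i => ?_⟩
  · rcases le_total q 1 with h | h
    · exact (mul_le_mul_of_nonneg_left (hm i (Finset.mem_univ i)) (by linarith)).trans hmV
    · have := (abs_nonneg _).trans (hV m)
      nlinarith [abs_nonneg (σ i)]
  · rcases le_total q 1 with h | h
    · nlinarith [hoff i]
    · have := (abs_nonneg _).trans (hV m)
      nlinarith [abs_nonneg (σ i - ⟪tensorPower n (a i), T⟫), mul_nonneg hq0 this]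

/-- The lower frame bound of the tensors `a_i^{⊗ n}`, from diagonal dominance of the Gram
matrix. -/
lemma mul_norm_sq_starProjection_powerSpan_le (ha : ∀ i, ‖a i‖ = 1)
    (hq : ∀ i, ∑ j ∈ Finset.univ.erase i, |⟪a i, a j⟫| ^ n ≤ q) (hq1 : q < 1) (T : Tens D n) :
    (1 - q) * ‖(powerSpan n a).starProjection T‖ ^ 2
      ≤ ∑ i, ⟪tensorPower n (a i), T⟫ ^ 2 := by
  obtain ⟨σ, hσ⟩ := Submodule.mem_span_range_iff_exists_fun ℝ |>.1
    ((powerSpan n a).starProjection_apply_mem T)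
  have hlin : ‖(powerSpan n a).starProjection T‖ ^ 2
      = ∑ i, σ i * ⟪tensorPower n (a i), T⟫ := by
    rw [← inner_starProjection_self, ← hσ, sum_inner]
    simp [real_inner_smul_left]
  have hquad : (1 - q) * ∑ i, σ i ^ 2 ≤ ‖(powerSpan n a).starProjection T‖ ^ 2 := by
    have e : ‖(powerSpan n a).starProjection T‖ ^ 2
        = ∑ i, σ i ^ 2 + ∑ i, ∑ j ∈ Finset.univ.erase i, σ i * σ j * ⟪a i, a j⟫ ^ n := by
      rw [← real_inner_self_eq_norm_sq, ← hσ, sum_inner, ← Finset.sum_add_distrib]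
      refine Finset.sum_congr rfl fun i _ => ?_
      rw [inner_sum, ← Finset.add_sum_erase _ _ (Finset.mem_univ i)]
      simp only [real_inner_smul_left, real_inner_smul_right, inner_tensorPower]
      rw [real_inner_self_eq_norm_sq, ha i]
      congr 1
      · ring
      · exact Finset.sum_congr rfl fun j _ => by ring
    have h1 : ∀ i, ∀ j, -((σ i ^ 2 * |⟪a i, a j⟫| ^ n + σ j ^ 2 * |⟪a j, a i⟫| ^ n) / 2)
        ≤ σ i * σ j * ⟪a i, a j⟫ ^ n := by
      intro i j
      rw [real_inner_comm (a i) (a j), ← abs_pow]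
      have h2 := neg_abs_le (σ i * σ j * ⟪a i, a j⟫ ^ n)
      rw [abs_mul, abs_mul] at h2
      rw [← sq_abs (σ i), ← sq_abs (σ j)]
      nlinarith [mul_nonneg (sq_nonneg (|σ i| - |σ j|)) (abs_nonneg (⟪a i, a j⟫ ^ n))]
    have h3 : ∑ i, ∑ j ∈ Finset.univ.erase i, σ i ^ 2 * |⟪a i, a j⟫| ^ n ≤ q * ∑ i, σ i ^ 2 := by
      rw [Finset.mul_sum]
      refine Finset.sum_le_sum fun i _ => ?_
      rw [← Finset.mul_sum, mul_comm]
      exact mul_le_mul_of_nonneg_right (hq i) (sq_nonneg _)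
    have h4 : ∑ i, ∑ j ∈ Finset.univ.erase i, σ j ^ 2 * |⟪a j, a i⟫| ^ n
        = ∑ i, ∑ j ∈ Finset.univ.erase i, σ i ^ 2 * |⟪a i, a j⟫| ^ n :=
      Finset.sum_comm' (by intro i j; simp [ne_comm])
    have h5 : ∑ i, ∑ j ∈ Finset.univ.erase i,
        -((σ i ^ 2 * |⟪a i, a j⟫| ^ n + σ j ^ 2 * |⟪a j, a i⟫| ^ n) / 2)
        ≤ ∑ i, ∑ j ∈ Finset.univ.erase i, σ i * σ j * ⟪a i, a j⟫ ^ n :=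
      Finset.sum_le_sum fun i _ => Finset.sum_le_sum fun j _ => h1 i j
    simp only [Finset.sum_neg_distrib, ← Finset.sum_div, Finset.sum_add_distrib, h4] at h5
    rw [e]
    linarith
  have hcs := Finset.sum_mul_sq_le_sq_mul_sq Finset.univ σ fun i => ⟪tensorPower n (a i), T⟫
  rw [← hlin] at hcs
  set N := ‖(powerSpan n a).starProjection T‖ ^ 2
  have hN : 0 ≤ N := by positivity
  rcases hN.eq_or_lt with h0 | h0
  · rw [← h0, mul_zero]; positivity
  · have hv : (0 : ℝ) ≤ ∑ i, ⟪tensorPower n (a i), T⟫ ^ 2 := by positivity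
    refine le_of_mul_le_mul_right ?_ h0
    calc (1 - q) * N * N = (1 - q) * N ^ 2 := by ring
      _ ≤ (1 - q) * ((∑ i, σ i ^ 2) * ∑ i, ⟪tensorPower n (a i), T⟫ ^ 2) :=
          mul_le_mul_of_nonneg_left hcs (by linarith)
      _ = ((1 - q) * ∑ i, σ i ^ 2) * ∑ i, ⟪tensorPower n (a i), T⟫ ^ 2 := by ring
      _ ≤ N * ∑ i, ⟪tensorPower n (a i), T⟫ ^ 2 := mul_le_mul_of_nonneg_right hquad hv
      _ = _ := by ring

end Frame

/-! ### Localization of second-order critical points -/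

section Perturbation

variable {D n : ℕ} (A B : Submodule ℝ (Tens D n))

lemma subspaceDist_nonneg : 0 ≤ subspaceDist A B := norm_nonneg _

lemma norm_starProjection_sub_le (T : Tens D n) :
    ‖A.starProjection T - B.starProjection T‖ ≤ subspaceDist A B * ‖T‖ :=
  (A.starProjection - B.starProjection).le_opNorm T

lemma abs_inner_starProjection_sub_le (S T : Tens D n) :
    |⟪A.starProjection S, T⟫ - ⟪B.starProjection S, T⟫| ≤ subspaceDist A B * (‖S‖ * ‖T‖) := by
  rw [← inner_sub_left, ← mul_assoc]
  exact (abs_real_inner_le_norm _ _).trans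
    (mul_le_mul_of_nonneg_right (norm_starProjection_sub_le A B S) (norm_nonneg _))

lemma abs_norm_sq_starProjection_sub_le (T : Tens D n) :
    |‖A.starProjection T‖ ^ 2 - ‖B.starProjection T‖ ^ 2| ≤ subspaceDist A B * ‖T‖ ^ 2 := by
  rw [← inner_starProjection_self, ← inner_starProjection_self, pow_two]
  exact abs_inner_starProjection_sub_le A B T T

lemma abs_spmObjective_sub_le {x : Vec D} (hx : ‖x‖ = 1) :
    |spmObjective A x - spmObjective B x| ≤ subspaceDist A B := by
  simpa [norm_tensorPower hx, spmObjective] using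
    abs_norm_sq_starProjection_sub_le A B (tensorPower n x)

/-- The error at a point whose tensor power lies in `A` is of second order. -/
lemma one_sub_sq_le_spmObjective {u : Vec D} (hu : ‖u‖ = 1) (huA : tensorPower n u ∈ A) :
    1 - subspaceDist A B ^ 2 ≤ spmObjective B u := by
  have h1 := norm_starProjection_sub_le A B (tensorPower n u)
  rw [A.starProjection_eq_self_iff.2 huA, norm_tensorPower hu, mul_one] at h1
  have h2 : ‖tensorPower n u - B.starProjection (tensorPower n u)‖ ^ 2
      = 1 - spmObjective B u := by
    rw [norm_sub_sq_real, real_inner_comm, inner_starProjection_self, norm_tensorPower hu,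
      spmObjective]
    ring
  nlinarith [norm_nonneg (tensorPower n u - B.starProjection (tensorPower n u))]

lemma inner_sq_le_norm_sq_starProjection {u : Vec D} (hu : ‖u‖ = 1) (huA : tensorPower n u ∈ A)
    (T : Tens D n) : ⟪tensorPower n u, T⟫ ^ 2 ≤ ‖A.starProjection T‖ ^ 2 := by
  rw [← A.starProjection_eq_self_iff.2 huA, inner_starProjection_comm, ← sq_abs]
  refine pow_le_pow_left₀ (abs_nonneg _) ?_ 2
  simpa [norm_tensorPower hu] using
    abs_real_inner_le_norm (tensorPower n u) (A.starProjection T)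

end Perturbation

section Hessian

variable {D n : ℕ} {B : Submodule ℝ (Tens D n)} {x : Vec D}

lemma inner_gradient_spmObjective_self :
    ⟪x, gradient (spmObjective B) x⟫ = 2 * n * spmObjective B x := by
  rw [real_inner_comm, inner_gradient_spmObjective, tensorPowerDeriv_self, real_inner_smul_right,
    inner_starProjection_self, spmObjective]
  ring

lemma sphereHess_spmObjective (z : Vec D) :
    sphereHess (spmObjective B) x z
      = 2 * ‖B.starProjection (tensorPowerDeriv n x z)‖ ^ 2
        + 2 * ⟪B.starProjection (tensorPower n x), tensorPowerDeriv₂ n x z z⟫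
        - 2 * n * spmObjective B x * ‖z‖ ^ 2 := by
  rw [sphereHess, inner_fderiv_gradient_spmObjective, inner_gradient_spmObjective_self,
    real_inner_self_eq_norm_sq]

/-- The second-order condition in the tangent direction `u - ⟨x, u⟩ x`, written in terms of the
derivatives in the direction `u`. -/
lemma IsSecondOrderCritical.deriv_le (hx : IsSecondOrderCritical (spmObjective B) x) {u : Vec D}
    (hu : ‖u‖ = 1) :
    ‖B.starProjection (tensorPowerDeriv n x u)‖ ^ 2
        + ⟪B.starProjection (tensorPower n x), tensorPowerDeriv₂ n x u u⟫
      ≤ n * (spmObjective B x * (1 + (2 * n - 2) * ⟪x, u⟫ ^ 2)) := by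
  obtain ⟨hx1, hgrad, hhess⟩ := hx
  set c := ⟪x, u⟫ with hc
  set F := spmObjective B x with hF
  have hux : ⟪u, x⟫ = c := by rw [real_inner_comm]
  have hxx : ⟪x, x⟫ = 1 := by rw [real_inner_self_eq_norm_sq, hx1]; norm_num
  have h1 : ⟪B.starProjection (tensorPower n x), tensorPowerDeriv n x u⟫ = n * F * c := by
    have h := congrArg (fun v => ⟪v, u⟫) hgrad
    simp only [sphereGrad, inner_sub_left, real_inner_smul_left, inner_zero_left,
      inner_gradient_spmObjective, inner_gradient_spmObjective_self] at h
    rw [← hc, ← hF] at h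
    linarith
  have h2 : ‖u - c • x‖ ^ 2 = 1 - c ^ 2 := by
    rw [← real_inner_self_eq_norm_sq]
    simp only [inner_sub_left, inner_sub_right, real_inner_smul_left, real_inner_smul_right,
      ← hc, hux, hxx]
    rw [real_inner_self_eq_norm_sq, hu]
    ring
  have h3 := hhess (u - c • x) (by rw [inner_sub_right, real_inner_smul_right, hxx]; simp [hc])
  have h4 : ‖B.starProjection (tensorPowerDeriv n x (u - c • x))‖ ^ 2
      = ‖B.starProjection (tensorPowerDeriv n x u)‖ ^ 2 - n ^ 2 * c ^ 2 * F := by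
    have e : ⟪B.starProjection (tensorPowerDeriv n x u), tensorPower n x⟫ = n * F * c := by
      rw [inner_starProjection_comm, real_inner_comm, h1]
    have e' : ⟪B.starProjection (tensorPower n x), tensorPower n x⟫ = F := by
      rw [inner_starProjection_self]; rfl
    rw [tensorPowerDeriv_sub_smul, tensorPowerDeriv_self, ← inner_starProjection_self]
    simp only [map_sub, map_smul, inner_sub_left, inner_sub_right, real_inner_smul_left,
      real_inner_smul_right, inner_starProjection_self, h1, e]
    rw [← inner_starProjection_self B (tensorPower n x), e']
    ring
  have h5 : ⟪B.starProjection (tensorPower n x),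
        tensorPowerDeriv₂ n x (u - c • x) (u - c • x)⟫
      = ⟪B.starProjection (tensorPower n x), tensorPowerDeriv₂ n x u u⟫
        - n * (n - 1) * c ^ 2 * F := by
    have e' : ⟪B.starProjection (tensorPower n x), tensorPower n x⟫ = F := by
      rw [inner_starProjection_self]; rfl
    rw [tensorPowerDeriv₂_sub_smul_right, tensorPowerDeriv₂_comm, tensorPowerDeriv₂_sub_smul_right,
      tensorPowerDeriv₂_self_right, tensorPowerDeriv₂_self_right, tensorPowerDeriv_sub_smul,
      tensorPowerDeriv_self]
    simp only [inner_sub_right, real_inner_smul_right, h1, e']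
    ring
  rw [sphereHess_spmObjective, h2, h4, h5] at h3
  nlinarith

end Hessian

section Landscape

variable {D K n : ℕ} {a : Fin K → Vec D}

lemma tensorPower_mem_powerSpan (i : Fin K) : tensorPower n (a i) ∈ powerSpan n a :=
  Submodule.subset_span ⟨i, rfl⟩

/-- The real arithmetic behind `IsSecondOrderCritical.exists_close`. Here `F` and `F₀` stand for the
noisy and the noiseless objective, `c2` for the largest `⟨x, a_i⟩ ^ 2`, and `M` for its power of
exponent `N - 1`. -/
lemma close_of_derivative_bounds {N r q Δ F F₀ G M c2 : ℝ} (hN : 2 ≤ N) (hr0 : 0 ≤ r)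
    (hr : r ≤ 1 / 24) (hq0 : 0 ≤ q) (hq : q ≤ 1 / 24) (hΔ0 : 0 ≤ Δ) (hF : 0 ≤ F)
    (hG : M * (1 - 2 * q - r) ≤ (1 - q) * G) (hE : F - Δ ≤ F₀)
    (hF₀ : (1 - q) * F₀ ≤ M * (1 + r))
    (hmain : N * M + (N - 1) * G ≤ F * (1 + (2 * N - 2) * c2) + (2 * N - 1) * Δ) :
    F * (1 - c2) ≤ 2 * (r + q) * F + 3 * Δ := by
  have hq1 : 0 < 1 - q := by linarith
  set b := N * (1 - q) + (N - 1) * (1 - 2 * q - r) with hb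
  have hb0 : 0 ≤ b := by
    have : 0 ≤ 1 - 2 * q - r := by linarith
    have : 0 ≤ (N - 1) * (1 - 2 * q - r) := mul_nonneg (by linarith) this
    have : 0 ≤ N * (1 - q) := mul_nonneg (by linarith) hq1.le
    linarith
  have h1 : M * b ≤ (1 - q) * (F * (1 + (2 * N - 2) * c2) + (2 * N - 1) * Δ) := by
    have e1 := mul_le_mul_of_nonneg_left hmain hq1.le
    have e2 := mul_le_mul_of_nonneg_left hG (show 0 ≤ N - 1 by linarith)
    rw [hb]
    linarith
  have h2 : (1 - q) * (F - Δ) ≤ M * (1 + r) :=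
    (mul_le_mul_of_nonneg_left hE hq1.le).trans hF₀
  have h3 : (F - Δ) * b ≤ (1 + r) * (F * (1 + (2 * N - 2) * c2) + (2 * N - 1) * Δ) := by
    have e1 := mul_le_mul_of_nonneg_left h1 (show 0 ≤ 1 + r by linarith)
    have e2 := mul_le_mul_of_nonneg_right h2 hb0
    refine le_of_mul_le_mul_left ?_ hq1
    linarith
  have h4 : b ≤ (2 * N - 1) * (1 + r) := by
    rw [hb]; nlinarith
  refine le_of_mul_le_mul_left ?_ (show 0 < (1 + r) * (2 * N - 2) by
    apply mul_pos <;> linarith)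
  have h5 := mul_le_mul_of_nonneg_right h4 hΔ0
  have h6 : 0 ≤ (r + q) * F := mul_nonneg (by linarith) hF
  have h7 : 0 ≤ (r + q) * F * r * (N - 1) := by
    refine mul_nonneg (mul_nonneg h6 hr0) (by linarith)
  have h8 : 0 ≤ (r + q) * F * (N - 2) := mul_nonneg h6 (by linarith)
  have h9 : 0 ≤ (1 + r) * Δ * (N - 2) := by
    refine mul_nonneg (mul_nonneg (by linarith) hΔ0) (by linarith)
  have h10 : 0 ≤ r * (N - 1) * F := mul_nonneg (mul_nonneg hr0 (by linarith)) hF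
  rw [hb] at h3 h5
  nlinarith

/-- A second-order critical point at which the objective dominates the distance `Δ` of the two
subspaces is close, up to sign, to one of the `a_i`, namely to the one for which `|⟨x, a_i⟩|` is
largest. With `c = ⟨x, a_i⟩`, the second-order condition in the direction `a_i - c x` compares
`(2 n - 1) c ^ (2 n - 2)`, from below, with `F (1 + (2 n - 2) c²)`, and `F` is at most
`c ^ (2 n - 2)`, all up to factors `1 + O(ρ)` and errors `O(Δ)`. -/
lemma IsSecondOrderCritical.exists_close (hK : 0 < K) (hn : 2 ≤ n) (ha : ∀ i, ‖a i‖ = 1)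
    (hr : frameConst a 2 ≤ 1 / 24) (hq : frameConst a n ≤ 1 / 24) {B : Submodule ℝ (Tens D n)}
    {x : Vec D} (hx : IsSecondOrderCritical (spmObjective B) x) :
    ∃ i, spmObjective B x * (1 - ⟪x, a i⟫ ^ 2)
      ≤ 2 * (frameConst a 2 + frameConst a n) * spmObjective B x
        + 3 * subspaceDist (powerSpan n a) B := by
  obtain ⟨i, -, hi⟩ := Finset.exists_max_image Finset.univ (fun i => |⟪x, a i⟫|)
    ⟨⟨0, hK⟩, Finset.mem_univ _⟩
  refine ⟨i, ?_⟩
  have hx1 := hx.1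
  have hr0 := frameConst_nonneg ha 2 i
  have hq0 := frameConst_nonneg ha n i
  have hsum := sum_inner_sq_le ha x
  have hrow := sum_erase_abs_inner_pow_le ha 2 i
  have hgram := sum_erase_abs_inner_pow_le ha n
  have hcrit := hx.deriv_le (ha i)
  set r := frameConst a 2
  set q := frameConst a n
  set A := powerSpan n a with hA
  set Δ := subspaceDist A B with hΔ
  set F := spmObjective B x with hF
  set c : Fin K → ℝ := fun j => ⟪x, a j⟫ with hc
  have hcomm : ∀ j, ⟪a j, x⟫ = c j := fun j => real_inner_comm _ _
  have hcv : ∀ j, ⟪tensorPower n (a j), tensorPower n x⟫ = c j ^ n := fun j => by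
    rw [inner_tensorPower, hcomm]
  have hmax : ∀ j, |c j| ≤ |c i| := fun j => hi j (Finset.mem_univ j)
  obtain ⟨σ, hσ, hσ1, hσ2⟩ := exists_coeff_starProjection_powerSpan ha hgram (tensorPower n x)
    (V := |c i| ^ n) fun j => by
      rw [hcv, abs_pow]; exact pow_le_pow_left₀ (abs_nonneg _) (hmax j) n
  set M : ℝ := (|c i| ^ (n - 1)) ^ 2 with hM
  have hM0 : 0 ≤ M := by positivity
  have hMV : |c i| ^ n * |c i| ^ (n - 2) = M := by
    rw [hM, ← pow_add, ← pow_mul]; congr 1; omega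
  have hterm : ∀ j, (1 - q) * |σ j * c j ^ (n - 2)| ≤ M := fun j => by
    rw [abs_mul, abs_pow, ← mul_assoc, ← hMV]
    exact mul_le_mul (hσ1 j) (pow_le_pow_left₀ (abs_nonneg _) (hmax j) _) (by positivity)
      (by positivity)
  -- The value of the noiseless objective is at most about `M`.
  have hF0 : (1 - q) * spmObjective A x ≤ M * (1 + r) := by
    have e : spmObjective A x = ∑ j, σ j * c j ^ (n - 2) * c j ^ 2 := by
      rw [spmObjective, ← inner_starProjection_self, hσ, sum_inner]
      refine Finset.sum_congr rfl fun j _ => ?_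
      rw [real_inner_smul_left, hcv, mul_assoc, ← pow_add]
      congr 2
      omega
    rw [e, Finset.mul_sum]
    calc ∑ j, (1 - q) * (σ j * c j ^ (n - 2) * c j ^ 2) ≤ ∑ j, M * c j ^ 2 := by
          refine Finset.sum_le_sum fun j _ => ?_
          rw [← mul_assoc]
          refine mul_le_mul_of_nonneg_right ?_ (sq_nonneg _)
          exact (mul_le_mul_of_nonneg_left (le_abs_self _) (by linarith)).trans (hterm j)
      _ ≤ M * (1 + r) := by
          rw [← Finset.mul_sum]
          refine mul_le_mul_of_nonneg_left ?_ hM0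
          simpa [hx1] using hsum
  -- Both second-derivative terms are at least about `n ^ 2 * M` and `n * (n - 1) * M`.
  have hG : M * (1 - 2 * q - r)
      ≤ (1 - q) * ∑ j, σ j * c j ^ (n - 2) * ⟪a j, a i⟫ ^ 2 := by
    rw [← Finset.add_sum_erase _ _ (Finset.mem_univ i), mul_add, Finset.mul_sum]
    have h1 : (1 - 2 * q) * M ≤ (1 - q) * (σ i * c i ^ (n - 2) * ⟪a i, a i⟫ ^ 2) := by
      have e1 : c i ^ n * c i ^ (n - 2) = M := by
        rw [hM, ← pow_mul, ← pow_add, mul_comm, pow_mul, sq_abs, ← pow_mul]; congr 1; omega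
      have e2 : (1 - q) * |(σ i - c i ^ n) * c i ^ (n - 2)| ≤ q * M := by
        rw [abs_mul, abs_pow, ← mul_assoc, ← hMV, ← mul_assoc]
        refine mul_le_mul_of_nonneg_right ?_ (by positivity)
        have := hσ2 i
        rwa [hcv] at this
      have e3 := mul_le_mul_of_nonneg_left
        (neg_abs_le ((σ i - c i ^ n) * c i ^ (n - 2))) (show 0 ≤ 1 - q by linarith)
      rw [real_inner_self_eq_norm_sq, ha i]
      have e4 : (1 - q) * ((σ i - c i ^ n) * c i ^ (n - 2))
          = (1 - q) * (σ i * c i ^ (n - 2)) - (1 - q) * M := by rw [← e1]; ring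
      linarith
    have h2 : -(M * r) ≤ ∑ j ∈ Finset.univ.erase i,
        (1 - q) * (σ j * c j ^ (n - 2) * ⟪a j, a i⟫ ^ 2) := by
      calc -(M * r) ≤ ∑ j ∈ Finset.univ.erase i, -(M * |⟪a i, a j⟫| ^ 2) := by
            rw [Finset.sum_neg_distrib, ← Finset.mul_sum]
            exact neg_le_neg (mul_le_mul_of_nonneg_left hrow hM0)
        _ ≤ _ := by
            refine Finset.sum_le_sum fun j _ => ?_
            rw [sq_abs, real_inner_comm (a j) (a i), ← mul_assoc, ← neg_mul]
            refine mul_le_mul_of_nonneg_right ?_ (sq_nonneg _)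
            have e := mul_le_mul_of_nonneg_left
              (neg_abs_le (σ j * c j ^ (n - 2))) (show 0 ≤ 1 - q by linarith)
            linarith [hterm j]
    linarith
  have hG' : ⟪A.starProjection (tensorPower n x), tensorPowerDeriv₂ n x (a i) (a i)⟫
      = n * ((n - 1) * ∑ j, σ j * c j ^ (n - 2) * ⟪a j, a i⟫ ^ 2) := by
    rw [hσ, sum_inner, Finset.mul_sum, Finset.mul_sum]
    refine Finset.sum_congr rfl fun j _ => ?_
    rw [real_inner_smul_left, inner_tensorPower_deriv₂, hcomm]
    ring
  have hH : (n : ℝ) ^ 2 * M ≤ ‖A.starProjection (tensorPowerDeriv n x (a i))‖ ^ 2 := by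
    have := inner_sq_le_norm_sq_starProjection A (ha i) (tensorPower_mem_powerSpan i)
      (tensorPowerDeriv n x (a i))
    rw [inner_tensorPower_deriv, real_inner_self_eq_norm_sq, ha i, hcomm] at this
    convert this using 1
    rw [hM, ← abs_pow, sq_abs]
    ring
  set G := ∑ j, σ j * c j ^ (n - 2) * ⟪a j, a i⟫ ^ 2
  have hn' : (2 : ℝ) ≤ n := by exact_mod_cast hn
  have hE1 := (abs_le.1 (abs_norm_sq_starProjection_sub_le A B (tensorPowerDeriv n x (a i)))).2
  have hE2 := (abs_le.1 (abs_inner_starProjection_sub_le A B (tensorPower n x)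
    (tensorPowerDeriv₂ n x (a i) (a i)))).2
  have hE3 := (abs_le.1 (abs_spmObjective_sub_le A B hx1)).1
  have hΔ0 : 0 ≤ Δ := subspaceDist_nonneg A B
  have hD1 : ‖tensorPowerDeriv n x (a i)‖ ^ 2 ≤ (n : ℝ) ^ 2 := by
    have := norm_tensorPowerDeriv_le (n := n) x (a i) hx1
    rw [ha i, mul_one] at this
    exact pow_le_pow_left₀ (norm_nonneg _) this 2
  have hD2 : ‖tensorPower n x‖ * ‖tensorPowerDeriv₂ n x (a i) (a i)‖ ≤ (n : ℝ) * (n - 1) := by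
    have := norm_tensorPowerDeriv₂_le (n := n) x (a i) (a i) hx1
    rw [ha i, mul_one, mul_one] at this
    rwa [norm_tensorPower hx1, one_mul]
  replace hE1 := hE1.trans (mul_le_mul_of_nonneg_left hD1 hΔ0)
  replace hE2 := hE2.trans (mul_le_mul_of_nonneg_left hD2 hΔ0)
  rw [hG'] at hE2
  have hF0' : 0 ≤ F := by rw [hF, spmObjective]; positivity
  have hmain : (n : ℝ) * M + (n - 1) * G
      ≤ F * (1 + (2 * n - 2) * c i ^ 2) + (2 * n - 1) * Δ := by
    refine le_of_mul_le_mul_left ?_ (show (0 : ℝ) < n by linarith)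
    linarith
  exact close_of_derivative_bounds hn' hr0 hr hq0 hq hΔ0 hF0' hG (by linarith) hF0 hmain

end Landscape

/-! ### Negative definite Hessian and quadratic decay near `± a_i` -/

section Cap

variable {D K n : ℕ} {a : Fin K → Vec D}

lemma one_sub_nat_mul_le_pow {t : ℝ} (ht : t ≤ 1) (m : ℕ) : 1 - m * t ≤ (1 - t) ^ m := by
  have := one_add_mul_le_pow (a := -t) (by linarith) m
  rw [← sub_eq_add_neg] at this
  linarith

lemma pow_le_one_sub_add {t : ℝ} (ht0 : 0 ≤ t) (ht : t ≤ 1) (m : ℕ) :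
    (1 - t) ^ m ≤ 1 - m * t + (m * t) ^ 2 := by
  have h1 := one_add_mul_le_pow (a := t) (by linarith) m
  have h2 : (1 - t) ^ m * (1 + t) ^ m ≤ 1 := by
    rw [← mul_pow]
    exact pow_le_one₀ (mul_nonneg (by linarith) (by linarith)) (by nlinarith)
  have h3 : (0 : ℝ) ≤ (1 - t) ^ m := pow_nonneg (by linarith) m
  have h4 : (0 : ℝ) ≤ m * t := by positivity
  have h5 : (1 - t) ^ m * (1 + m * t) ≤ 1 := (mul_le_mul_of_nonneg_left h1 h3).trans h2
  nlinarith [mul_nonneg h4 (sq_nonneg (m * t))]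

lemma inner_sq_le_one {x y : Vec D} (hx : ‖x‖ = 1) (hy : ‖y‖ = 1) : ⟪x, y⟫ ^ 2 ≤ 1 := by
  have := abs_real_inner_le_norm x y
  rw [hx, hy, mul_one] at this
  exact (sq_le_one_iff_abs_le_one _).2 this

lemma norm_sub_inner_smul_sq {x y : Vec D} (hx : ‖x‖ = 1) (hy : ‖y‖ = 1) :
    ‖x - ⟪x, y⟫ • y‖ ^ 2 = 1 - ⟪x, y⟫ ^ 2 := by
  rw [norm_sub_sq_real, real_inner_smul_right, norm_smul, hx, hy, Real.norm_eq_abs, mul_one, sq_abs]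
  ring

/-- A direction tangent to the sphere at `x` is nearly orthogonal to every vector near `x`. -/
lemma inner_sq_le_of_inner_eq_zero {x y z : Vec D} (hx : ‖x‖ = 1) (hy : ‖y‖ = 1) (hz : ‖z‖ = 1)
    (hxz : ⟪x, z⟫ = 0) : ⟪z, y⟫ ^ 2 ≤ 1 - ⟪x, y⟫ ^ 2 := by
  have h1 : ⟪z, y⟫ = ⟪z, y - ⟪y, x⟫ • x⟫ := by
    rw [inner_sub_right, real_inner_smul_right, real_inner_comm x z, hxz]; ring
  have h2 := abs_real_inner_le_norm z (y - ⟪y, x⟫ • x)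
  rw [← h1, hz, one_mul] at h2
  rw [← sq_abs, real_inner_comm y x, ← norm_sub_inner_smul_sq hy hx]
  exact pow_le_pow_left₀ (abs_nonneg _) h2 2

lemma inner_sq_le_of_ne (ha : ∀ i, ‖a i‖ = 1) {x : Vec D} (hx : ‖x‖ = 1) {i j : Fin K}
    (hij : j ≠ i) : ⟪x, a j⟫ ^ 2 ≤ 1 - ⟪x, a i⟫ ^ 2 + frameConst a 2 := by
  have h1 := sum_inner_sq_le ha x
  rw [← Finset.add_sum_erase _ _ (Finset.mem_univ i)] at h1
  have h2 := Finset.single_le_sum (f := fun j => ⟪x, a j⟫ ^ 2) (fun _ _ => sq_nonneg _)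
    (Finset.mem_erase.2 ⟨hij, Finset.mem_univ j⟩)
  rw [hx] at h1
  linarith

/-- The real arithmetic behind `sphereHess_neg_of_close`: `t` is the squared sine of the distance
to the center of the cap, and `W`, `U` bound the two derivative terms of the Hessian. -/
lemma hessian_bound_lt_one {N r q Δ t W U : ℝ} (hN : 2 ≤ N) (hr0 : 0 ≤ r) (hq0 : 0 ≤ q)
    (hrq : N ^ 2 * r + (N ^ 2 + N) * q ≤ 1 / 6) (hΔ : 9 * N ^ 2 * Δ ≤ 1)
    (ht0 : 0 ≤ t) (ht : 3 * N ^ 2 * t ≤ 1)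
    (hW : (1 - q) * W ≤ t + (t + r) * (1 + r))
    (hU : (1 - q) * U ≤ t + (t + r + q) * (1 + r)) :
    N * W + (N - 1) * U + 2 * N * Δ + N * t < 1 := by
  have hN2 : 4 ≤ N ^ 2 := by nlinarith
  have hr : r ≤ 1 / 24 := by nlinarith [mul_nonneg (show 0 ≤ N ^ 2 + N by positivity) hq0]
  have hq : q ≤ 1 / 36 := by nlinarith [mul_nonneg (show 0 ≤ N ^ 2 by positivity) hr0]
  have hS : N ^ 2 * (t + r + q) ≤ 1 / 2 := by nlinarith [mul_nonneg (show 0 ≤ N by linarith) hq0]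
  have hbd : ∀ X : ℝ, (1 - q) * X ≤ t + (t + r + q) * (1 + r) → N ^ 2 * X ≤ 22 / 25 := by
    intro X hX
    rcases le_total X 0 with h | h
    · nlinarith
    have h1 : 35 / 36 * X ≤ t + (t + r + q) * (25 / 24) := by
      have e1 : 35 / 36 * X ≤ (1 - q) * X := mul_le_mul_of_nonneg_right (by linarith) h
      have e2 : (t + r + q) * (1 + r) ≤ (t + r + q) * (25 / 24) :=
        mul_le_mul_of_nonneg_left (by linarith) (by linarith)
      linarith
    have h2 := mul_le_mul_of_nonneg_left h1 (show 0 ≤ N ^ 2 by positivity)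
    nlinarith
  have hW' := hbd W (hW.trans (by nlinarith [mul_nonneg hq0 (show 0 ≤ 1 + r by linarith)]))
  have hU' := hbd U hU
  refine lt_of_mul_lt_mul_left (a := N ^ 2) ?_ (by positivity)
  have e1 := mul_le_mul_of_nonneg_left hW' (show 0 ≤ N by linarith)
  have e2 := mul_le_mul_of_nonneg_left hU' (show 0 ≤ N - 1 by linarith)
  have e3 := mul_le_mul_of_nonneg_left hΔ (show 0 ≤ N by linarith)
  have e4 := mul_le_mul_of_nonneg_left ht (show 0 ≤ N by linarith)
  nlinarith

/-- The Riemannian Hessian is negative definite at every point close to some `± a_i`. -/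
lemma sphereHess_neg_of_close (hn : 2 ≤ n) (ha : ∀ i, ‖a i‖ = 1)
    (hrq : (n : ℝ) ^ 2 * frameConst a 2 + ((n : ℝ) ^ 2 + n) * frameConst a n ≤ 1 / 6)
    {B : Submodule ℝ (Tens D n)} (hΔ : 9 * (n : ℝ) ^ 2 * subspaceDist (powerSpan n a) B ≤ 1)
    {x : Vec D} (hx : ‖x‖ = 1) {i : Fin K} (hxi : 3 * (n : ℝ) ^ 2 * (1 - ⟪x, a i⟫ ^ 2) ≤ 1)
    {z : Vec D} (hz : ‖z‖ = 1) (hxz : ⟪x, z⟫ = 0) :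
    sphereHess (spmObjective B) x z < 0 := by
  have hn' : (2 : ℝ) ≤ n := by exact_mod_cast hn
  have hr0 := frameConst_nonneg ha 2 i
  have hq0 := frameConst_nonneg ha n i
  have hsum := sum_inner_sq_le ha z
  have hgram := sum_erase_abs_inner_pow_le ha n
  have hzi := inner_sq_le_of_inner_eq_zero hx (ha i) hz hxz
  have hoff : ∀ j, j ≠ i → _ := fun j hj => inner_sq_le_of_ne ha hx hj
  have hle1 : ∀ j, ⟪x, a j⟫ ^ 2 ≤ 1 := fun j => inner_sq_le_one hx (ha j)
  set r := frameConst a 2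
  set q := frameConst a n
  set A := powerSpan n a with hA
  set Δ := subspaceDist A B with hΔdef
  set c : Fin K → ℝ := fun j => ⟪x, a j⟫ with hc
  set β : Fin K → ℝ := fun j => ⟪z, a j⟫ with hβ
  set t := 1 - ⟪x, a i⟫ ^ 2 with ht
  have hcomm : ∀ j, ⟪a j, x⟫ = c j := fun j => real_inner_comm _ _
  have hcommz : ∀ j, ⟪a j, z⟫ = β j := fun j => real_inner_comm _ _
  have ht0 : 0 ≤ t := by linarith [hle1 i]
  have hq : q ≤ 1 / 36 := by
    nlinarith [mul_nonneg (show 0 ≤ (n : ℝ) ^ 2 by positivity) hr0,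
      mul_nonneg (show 0 ≤ (n : ℝ) ^ 2 + n - 6 by nlinarith) hq0]
  have habs : ∀ j, |c j| ≤ 1 := fun j => (sq_le_one_iff_abs_le_one _).1 (hle1 j)
  have hβsum : ∑ j ∈ Finset.univ.erase i, β j ^ 2 ≤ 1 + r := by
    refine (Finset.sum_le_sum_of_subset_of_nonneg (Finset.erase_subset _ _)
      fun _ _ _ => sq_nonneg _).trans ?_
    simpa [hz] using hsum
  set W := (‖A.starProjection (tensorPowerDeriv n x z)‖ / n) ^ 2 with hWdef
  have hWeq : ‖A.starProjection (tensorPowerDeriv n x z)‖ ^ 2 = (n : ℝ) ^ 2 * W := by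
    rw [hWdef, div_pow, mul_div_cancel₀ _ (by positivity)]
  have hW : (1 - q) * W ≤ t + (t + r) * (1 + r) := by
    have h := mul_norm_sq_starProjection_powerSpan_le ha hgram (by linarith)
      (tensorPowerDeriv n x z)
    rw [hWeq] at h
    have e : ∀ j, ⟪tensorPower n (a j), tensorPowerDeriv n x z⟫ ^ 2
        = (n : ℝ) ^ 2 * ((c j ^ (n - 1)) ^ 2 * β j ^ 2) := fun j => by
      rw [inner_tensorPower_deriv, hcomm, hcommz]; ring
    simp only [e, ← Finset.mul_sum] at h
    have h' : (1 - q) * W ≤ ∑ j, (c j ^ (n - 1)) ^ 2 * β j ^ 2 :=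
      le_of_mul_le_mul_left (a := (n : ℝ) ^ 2) (by linarith) (by positivity)
    refine h'.trans ?_
    rw [← Finset.add_sum_erase _ _ (Finset.mem_univ i)]
    have hpow : ∀ j, (c j ^ (n - 1)) ^ 2 ≤ c j ^ 2 := fun j => by
      rw [← pow_mul, mul_comm, pow_mul]
      exact pow_le_of_le_one (sq_nonneg _) (hle1 j) (by omega)
    refine add_le_add ?_ ?_
    · exact (mul_le_of_le_one_left (sq_nonneg _) ((hpow i).trans (hle1 i))).trans hzi
    · calc ∑ j ∈ Finset.univ.erase i, (c j ^ (n - 1)) ^ 2 * β j ^ 2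
          ≤ ∑ j ∈ Finset.univ.erase i, (t + r) * β j ^ 2 :=
            Finset.sum_le_sum fun j hj => mul_le_mul_of_nonneg_right
              ((hpow j).trans (hoff j (Finset.ne_of_mem_erase hj))) (sq_nonneg _)
        _ ≤ (t + r) * (1 + r) := by
            rw [← Finset.mul_sum]
            exact mul_le_mul_of_nonneg_left hβsum (by linarith)
  have hcv : ∀ j, ⟪tensorPower n (a j), tensorPower n x⟫ = c j ^ n := fun j => by
    rw [inner_tensorPower, hcomm]
  obtain ⟨σ, hσ, hσ1, hσ2⟩ := exists_coeff_starProjection_powerSpan ha hgram (tensorPower n x)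
    (V := 1) fun j => by
      rw [hcv, abs_pow]; exact pow_le_one₀ (abs_nonneg _) (habs j)
  set U := ∑ j, σ j * c j ^ (n - 2) * β j ^ 2 with hUdef
  have hUeq : ⟪A.starProjection (tensorPower n x), tensorPowerDeriv₂ n x z z⟫
      = n * ((n - 1) * U) := by
    rw [hσ, sum_inner, hUdef, Finset.mul_sum, Finset.mul_sum]
    refine Finset.sum_congr rfl fun j _ => ?_
    rw [real_inner_smul_left, inner_tensorPower_deriv₂, hcomm, hcommz]
    ring
  have hU : (1 - q) * U ≤ t + (t + r + q) * (1 + r) := by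
    have hterm : ∀ j, (1 - q) * (σ j * c j ^ (n - 2) * β j ^ 2) ≤ (1 - q) * |σ j| * β j ^ 2 := by
      intro j
      rw [← mul_assoc]
      refine mul_le_mul_of_nonneg_right ?_ (sq_nonneg _)
      refine mul_le_mul_of_nonneg_left ((le_abs_self _).trans ?_) (by linarith)
      rw [abs_mul, abs_pow]
      exact mul_le_of_le_one_right (abs_nonneg _) (pow_le_one₀ (abs_nonneg _) (habs j))
    rw [hUdef, Finset.mul_sum, ← Finset.add_sum_erase _ _ (Finset.mem_univ i)]
    refine add_le_add ?_ ?_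
    · exact ((hterm i).trans (mul_le_of_le_one_left (sq_nonneg _) (hσ1 i))).trans hzi
    · have hσj : ∀ j, j ≠ i → (1 - q) * |σ j| ≤ t + r + q := by
        intro j hj
        have h1 := hσ2 j
        rw [hcv] at h1
        have h2 := abs_sub_abs_le_abs_sub (σ j) (c j ^ n)
        have h3 : |c j ^ n| ≤ t + r := by
          rw [abs_pow]
          refine (pow_le_pow_of_le_one (abs_nonneg _) (habs j) hn).trans ?_
          rw [sq_abs]
          exact hoff j hj
        have h4 := mul_le_mul_of_nonneg_left h2 (show 0 ≤ 1 - q by linarith)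
        nlinarith [abs_nonneg (c j ^ n)]
      calc ∑ j ∈ Finset.univ.erase i, (1 - q) * (σ j * c j ^ (n - 2) * β j ^ 2)
          ≤ ∑ j ∈ Finset.univ.erase i, (t + r + q) * β j ^ 2 :=
            Finset.sum_le_sum fun j hj => (hterm j).trans
              (mul_le_mul_of_nonneg_right (hσj j (Finset.ne_of_mem_erase hj)) (sq_nonneg _))
        _ ≤ (t + r + q) * (1 + r) := by
            rw [← Finset.mul_sum]
            exact mul_le_mul_of_nonneg_left hβsum (by linarith)
  have hF0 : 1 - n * t ≤ spmObjective A x := by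
    have h1 := inner_sq_le_norm_sq_starProjection A (ha i) (tensorPower_mem_powerSpan i)
      (tensorPower n x)
    rw [hcv, ← pow_mul, mul_comm, pow_mul] at h1
    have h2 := one_sub_nat_mul_le_pow (t := t) (by nlinarith [sq_nonneg ⟪x, a i⟫]) n
    have h3 : 1 - t = c i ^ 2 := by rw [ht]; ring
    rw [h3] at h2
    exact h2.trans h1
  have hE1 := (abs_le.1 (abs_norm_sq_starProjection_sub_le A B (tensorPowerDeriv n x z))).1
  have hE2 := (abs_le.1 (abs_inner_starProjection_sub_le A B (tensorPower n x)
    (tensorPowerDeriv₂ n x z z))).1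
  have hE3 := (abs_le.1 (abs_spmObjective_sub_le A B hx)).2
  have hΔ0 : 0 ≤ Δ := subspaceDist_nonneg A B
  have hD1 : ‖tensorPowerDeriv n x z‖ ^ 2 ≤ (n : ℝ) ^ 2 := by
    have := norm_tensorPowerDeriv_le (n := n) x z hx
    rw [hz, mul_one] at this
    exact pow_le_pow_left₀ (norm_nonneg _) this 2
  have hD2 : ‖tensorPower n x‖ * ‖tensorPowerDeriv₂ n x z z‖ ≤ (n : ℝ) * (n - 1) := by
    have := norm_tensorPowerDeriv₂_le (n := n) x z z hx
    rw [hz, mul_one, mul_one] at this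
    rwa [norm_tensorPower hx, one_mul]
  have hE1' := mul_le_mul_of_nonneg_left hD1 hΔ0
  have hE2' := mul_le_mul_of_nonneg_left hD2 hΔ0
  rw [hWeq, ← hΔdef] at hE1
  rw [hUeq, ← hΔdef] at hE2
  rw [← hΔdef] at hE3
  have hlt := hessian_bound_lt_one hn' hr0 hq0 hrq hΔ ht0 hxi hW hU
  rw [sphereHess_spmObjective, hz]
  have hlt' := mul_lt_mul_of_pos_left hlt (show (0 : ℝ) < n by linarith)
  have hE3' := mul_le_mul_of_nonneg_left hE3 (show (0 : ℝ) ≤ n by linarith)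
  have hF0' := mul_le_mul_of_nonneg_left hF0 (show (0 : ℝ) ≤ n by linarith)
  clear_value W U Δ t
  linarith

/-- The real arithmetic behind `spmObjective_powerSpan_le_of_close`. -/
lemma pow_add_remainder_le {r q t Q : ℝ} (hn : 2 ≤ n) (hr0 : 0 ≤ r) (hq0 : 0 ≤ q)
    (hrq : (n : ℝ) ^ 2 * r + ((n : ℝ) ^ 2 + n) * q ≤ 1 / 6)
    (ht0 : 0 ≤ t) (ht : 3 * (n : ℝ) ^ 2 * t ≤ 1)
    (hQ : (1 - q) * Q ≤ (n : ℝ) ^ 2 * (t + r) * ((1 + r) * t)) :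
    (1 - t) ^ n + Q ≤ 1 - 9 / 16 * n * t := by
  have hN : (2 : ℝ) ≤ n := by exact_mod_cast hn
  have h0 := pow_le_one_sub_add ht0 (by nlinarith) n
  generalize (n : ℝ) = N at *
  have hN2 : 4 ≤ N ^ 2 := by nlinarith
  have hr : r ≤ 1 / 24 := by nlinarith [mul_nonneg (show 0 ≤ N ^ 2 + N by positivity) hq0]
  have hq : q ≤ 1 / 36 := by nlinarith [mul_nonneg (show 0 ≤ N ^ 2 by positivity) hr0]
  have hS : N ^ 2 * (t + r) ≤ 1 / 2 := by
    nlinarith [mul_nonneg (show 0 ≤ N ^ 2 + N by positivity) hq0]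
  have h1 : N ^ 2 * (t + r) * ((1 + r) * t) ≤ 1 / 2 * (25 / 24 * t) :=
    mul_le_mul hS (mul_le_mul_of_nonneg_right (by linarith) ht0)
      (mul_nonneg (by linarith) ht0) (by norm_num)
  have h2 : Q ≤ 27 / 50 * t := by
    rcases le_total Q 0 with h | h
    · linarith
    · have : 35 / 36 * Q ≤ (1 - q) * Q := mul_le_mul_of_nonneg_right (by linarith) h
      linarith
  have h3 : (N * t) ^ 2 ≤ 1 / 6 * (N * t) := by
    have : N * t ≤ 1 / 6 := by nlinarith
    nlinarith [mul_nonneg (show 0 ≤ N by linarith) ht0]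
  nlinarith

/-- The noiseless objective decays quadratically away from `± a_i`. In the decomposition
`x^{⊗ n} = ⟨x, a_i⟩ ^ n a_i^{⊗ n} + T`, the projection of `T` is orthogonal to `a_i^{⊗ n}`. -/
lemma spmObjective_powerSpan_le_of_close (hn : 2 ≤ n) (ha : ∀ i, ‖a i‖ = 1)
    (hrq : (n : ℝ) ^ 2 * frameConst a 2 + ((n : ℝ) ^ 2 + n) * frameConst a n ≤ 1 / 6)
    {x : Vec D} (hx : ‖x‖ = 1) {i : Fin K} (hxi : 3 * (n : ℝ) ^ 2 * (1 - ⟪x, a i⟫ ^ 2) ≤ 1) :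
    spmObjective (powerSpan n a) x ≤ 1 - 9 / 16 * n * (1 - ⟪x, a i⟫ ^ 2) := by
  have hn' : (2 : ℝ) ≤ n := by exact_mod_cast hn
  have hr0 := frameConst_nonneg ha 2 i
  have hq0 := frameConst_nonneg ha n i
  have hsum := sum_inner_sq_le ha (x - ⟪x, a i⟫ • a i)
  rw [norm_sub_inner_smul_sq hx (ha i)] at hsum
  have hgram := sum_erase_abs_inner_pow_le ha n
  have hoff : ∀ j, j ≠ i → _ := fun j hj => inner_sq_le_of_ne ha hx hj
  have hoff' : ∀ j, j ≠ i → _ := fun j hj => inner_sq_le_of_ne ha (ha i) hj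
  have hle1 : ⟪x, a i⟫ ^ 2 ≤ 1 := inner_sq_le_one hx (ha i)
  set r := frameConst a 2
  set q := frameConst a n
  set A := powerSpan n a with hA
  set c := ⟪x, a i⟫ with hc
  set t := 1 - c ^ 2 with ht
  have ht0 : 0 ≤ t := by linarith
  have hq : q ≤ 1 / 36 := by
    nlinarith [mul_nonneg (show 0 ≤ (n : ℝ) ^ 2 by positivity) hr0,
      mul_nonneg (show 0 ≤ (n : ℝ) ^ 2 + n - 6 by nlinarith) hq0]
  set T := tensorPower n x - c ^ n • tensorPower n (a i) with hT
  have hTj : ∀ j, ⟪tensorPower n (a j), T⟫ = ⟪x, a j⟫ ^ n - (c * ⟪a i, a j⟫) ^ n := fun j => by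
    rw [hT, inner_sub_right, real_inner_smul_right, inner_tensorPower, inner_tensorPower,
      real_inner_comm x, real_inner_comm (a i), mul_pow]
  have hTi : ⟪tensorPower n (a i), T⟫ = 0 := by
    rw [hTj, real_inner_self_eq_norm_sq, ha i]; simp [hc]
  have hfix : A.starProjection (tensorPower n (a i)) = tensorPower n (a i) :=
    A.starProjection_eq_self_iff.2 (tensorPower_mem_powerSpan i)
  have hpyth : spmObjective A x = (1 - t) ^ n + ‖A.starProjection T‖ ^ 2 := by
    have e : A.starProjection (tensorPower n x)
        = c ^ n • tensorPower n (a i) + A.starProjection T := by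
      rw [hT, map_sub, map_smul, hfix]; abel
    have e' : ⟪tensorPower n (a i), A.starProjection T⟫ = 0 := by
      rw [← inner_starProjection_comm, hfix, hTi]
    have e'' : 1 - t = c ^ 2 := by rw [ht]; ring
    rw [spmObjective, e, norm_add_sq_real, real_inner_smul_left, e', norm_smul,
      norm_tensorPower (ha i), e'', Real.norm_eq_abs, mul_one, sq_abs]
    ring
  have hQ : (1 - q) * ‖A.starProjection T‖ ^ 2 ≤ (n : ℝ) ^ 2 * (t + r) * ((1 + r) * t) := by
    refine (mul_norm_sq_starProjection_powerSpan_le ha hgram (by linarith) T).trans ?_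
    have hbd : ∀ j, ⟪tensorPower n (a j), T⟫ ^ 2
        ≤ (n : ℝ) ^ 2 * (t + r) * ⟪x - c • a i, a j⟫ ^ 2 := by
      intro j
      rcases eq_or_ne j i with rfl | hj
      · rw [hTi, zero_pow two_ne_zero]
        have : 0 ≤ (n : ℝ) ^ 2 * (t + r) := mul_nonneg (by positivity) (by linarith)
        exact mul_nonneg this (sq_nonneg _)
      have htr1 : t + r ≤ 1 := by
        nlinarith [mul_nonneg (show 0 ≤ (n : ℝ) ^ 2 + n by positivity) hq0]
      have htr0 : 0 ≤ t + r := by linarith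
      set m := max |⟪x, a j⟫| |c * ⟪a i, a j⟫| with hm
      have hm0 : 0 ≤ m := (abs_nonneg _).trans (le_max_left _ _)
      have hm2 : m ^ 2 ≤ t + r := by
        have h1 : ⟪x, a j⟫ ^ 2 ≤ t + r := hoff j hj
        have h2 : (c * ⟪a i, a j⟫) ^ 2 ≤ t + r := by
          have h3 := hoff' j hj
          rw [real_inner_self_eq_norm_sq, ha i] at h3
          rw [mul_pow]
          have := mul_le_mul_of_nonneg_right hle1 (sq_nonneg ⟪a i, a j⟫)
          linarith
        rcases max_choice |⟪x, a j⟫| |c * ⟪a i, a j⟫| with h | h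
        · rw [hm, h, sq_abs]; exact h1
        · rw [hm, h, sq_abs]; exact h2
      have hmn : (m ^ (n - 1)) ^ 2 ≤ t + r := by
        rw [← pow_mul, mul_comm, pow_mul]
        exact (pow_le_of_le_one (sq_nonneg _) (hm2.trans htr1) (by omega)).trans hm2
      have h1 := abs_pow_sub_pow_le ⟪x, a j⟫ (c * ⟪a i, a j⟫) n
      rw [← hm] at h1
      have h2 : ⟪x - c • a i, a j⟫ = ⟪x, a j⟫ - c * ⟪a i, a j⟫ := by
        rw [inner_sub_left, real_inner_smul_left]
      rw [hTj, h2, ← sq_abs]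
      refine (pow_le_pow_left₀ (abs_nonneg _) h1 2).trans ?_
      rw [mul_pow, mul_pow, sq_abs]
      have := mul_le_mul_of_nonneg_left hmn
        (show 0 ≤ (n : ℝ) ^ 2 * (⟪x, a j⟫ - c * ⟪a i, a j⟫) ^ 2 by positivity)
      linarith
    refine (Finset.sum_le_sum fun j _ => hbd j).trans ?_
    rw [← Finset.mul_sum]
    exact mul_le_mul_of_nonneg_left hsum (mul_nonneg (by positivity) (by linarith))
  rw [hpyth]
  exact pow_add_remainder_le hn hr0 hq0 hrq ht0 hxi hQ

end Cap

/-! ### The caps around `± a_i` -/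

section Components

variable {D K n : ℕ} {a : Fin K → Vec D} {B : Submodule ℝ (Tens D n)}

/-- The vector `s a_i` for the index `i` and the sign `s`. -/
noncomputable def signedVec (a : Fin K → Vec D) (p : Fin K × ℤˣ) : Vec D :=
  ((p.2 : ℤ) : ℝ) • a p.1

lemma sq_sign (s : ℤˣ) : (((s : ℤ) : ℝ)) ^ 2 = 1 := by
  rcases Int.units_eq_one_or s with rfl | rfl <;> norm_num

lemma norm_signedVec (ha : ∀ i, ‖a i‖ = 1) (p : Fin K × ℤˣ) : ‖signedVec a p‖ = 1 := by
  rw [signedVec, norm_smul, ha, mul_one, Real.norm_eq_abs,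
    ← pow_eq_one_iff_of_nonneg (abs_nonneg _) two_ne_zero, sq_abs, sq_sign]

lemma inner_signedVec_sq (x : Vec D) (p : Fin K × ℤˣ) :
    ⟪x, signedVec a p⟫ ^ 2 = ⟪x, a p.1⟫ ^ 2 := by
  rw [signedVec, real_inner_smul_right, mul_pow, sq_sign, one_mul]

lemma tensorPower_signedVec_mem (p : Fin K × ℤˣ) :
    tensorPower n (signedVec a p) ∈ powerSpan n a := by
  have : tensorPower n (signedVec a p) = ((p.2 : ℤ) : ℝ) ^ n • tensorPower n (a p.1) := by
    ext j
    simp [tensorPower, signedVec, Finset.prod_mul_distrib]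
  rw [this]
  exact Submodule.smul_mem _ _ (tensorPower_mem_powerSpan _)

/-- The cosine of the angular radius of the caps around the `± a_i`: the squared sine is
`1 / (3 n²)`. -/
noncomputable def capCos (n : ℕ) : ℝ := √(1 - 1 / (3 * (n : ℝ) ^ 2))

lemma capCos_sq (hn : 2 ≤ n) : capCos n ^ 2 = 1 - 1 / (3 * (n : ℝ) ^ 2) := by
  have hn' : (2 : ℝ) ≤ n := by exact_mod_cast hn
  refine Real.sq_sqrt ?_
  rw [sub_nonneg, div_le_one (by positivity)]
  nlinarith

lemma mul_one_sub_capCos_sq (hn : 2 ≤ n) : 3 * (n : ℝ) ^ 2 * (1 - capCos n ^ 2) = 1 := by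
  have hn' : (2 : ℝ) ≤ n := by exact_mod_cast hn
  rw [capCos_sq hn]
  field_simp
  ring

lemma le_capCos (hn : 2 ≤ n) : 19 / 20 ≤ capCos n := by
  have hn' : (2 : ℝ) ≤ n := by exact_mod_cast hn
  refine Real.le_sqrt_of_sq_le ?_
  have : 1 / (3 * (n : ℝ) ^ 2) ≤ 1 / 12 :=
    one_div_le_one_div_of_le (by norm_num) (by nlinarith)
  linarith

lemma capCos_le_one (n : ℕ) : capCos n ≤ 1 :=
  Real.sqrt_le_one.2 (sub_le_self _ (by positivity))

lemma close_of_capCos_le (hn : 2 ≤ n) {x : Vec D} {p : Fin K × ℤˣ}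
    (hx : capCos n ≤ ⟪x, signedVec a p⟫) : 3 * (n : ℝ) ^ 2 * (1 - ⟪x, a p.1⟫ ^ 2) ≤ 1 := by
  have h := pow_le_pow_left₀ (by linarith [le_capCos hn]) hx 2
  rw [inner_signedVec_sq] at h
  exact (mul_le_mul_of_nonneg_left (by linarith) (by positivity)).trans
    (mul_one_sub_capCos_sq hn).le

lemma exists_sign_inner_eq_abs (x : Vec D) (i : Fin K) :
    ∃ s : ℤˣ, ⟪x, signedVec a (i, s)⟫ = |⟪x, a i⟫| := by
  rcases abs_choice ⟪x, a i⟫ with h | h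
  · exact ⟨1, by simp [signedVec, h]⟩
  · exact ⟨-1, by simp [signedVec, h]⟩

/-- The caps around the `± a_i` are disjoint, by the upper frame bound. -/
lemma eq_of_mem_caps (hn : 2 ≤ n) (ha : ∀ i, ‖a i‖ = 1) (hr : frameConst a 2 ≤ 1 / 24)
    {x : Vec D} (hx : ‖x‖ = 1) {p p' : Fin K × ℤˣ} (h : capCos n ≤ ⟪x, signedVec a p⟫)
    (h' : capCos n ≤ ⟪x, signedVec a p'⟫) : p = p' := by
  have hκ := le_capCos hn
  obtain ⟨i, s⟩ := p
  obtain ⟨j, s'⟩ := p'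
  rcases eq_or_ne j i with rfl | hij
  · congr 1
    simp only [signedVec, real_inner_smul_right] at h h'
    rcases Int.units_eq_one_or s with rfl | rfl <;>
      rcases Int.units_eq_one_or s' with rfl | rfl <;> first | rfl | (norm_num at h h'; linarith)
  · have h1 := inner_sq_le_of_ne ha hx hij
    have h2 := inner_signedVec_sq (a := a) x (i, s)
    have h3 := inner_signedVec_sq (a := a) x (j, s')
    simp only at h2 h3
    nlinarith

/-- A critical point in a cap is the strict maximizer over that cap. -/
lemma lt_of_critical_of_mem_cap (hn : 2 ≤ n) (ha : ∀ i, ‖a i‖ = 1)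
    (hrq : (n : ℝ) ^ 2 * frameConst a 2 + ((n : ℝ) ^ 2 + n) * frameConst a n ≤ 1 / 6)
    (hΔ : 9 * (n : ℝ) ^ 2 * subspaceDist (powerSpan n a) B ≤ 1)
    {p : Fin K × ℤˣ} {x y : Vec D} (hx : ‖x‖ = 1)
    (hxp : capCos n ≤ ⟪x, signedVec a p⟫) (hgrad : sphereGrad (spmObjective B) x = 0)
    (hy : ‖y‖ = 1) (hyp : capCos n ≤ ⟪y, signedVec a p⟫) (hne : y ≠ x) :
    spmObjective B y < spmObjective B x :=
  lt_of_sphereHess_neg_on_cap (contDiff_spmObjective B) (by linarith [le_capCos hn])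
    (fun _ hw hwp _ hz hwz =>
      sphereHess_neg_of_close hn ha hrq hΔ hw (close_of_capCos_le hn hwp) hz hwz)
    hx hxp hgrad hy hyp hne

lemma spmObjective_le_of_mem_cap (hn : 2 ≤ n) (ha : ∀ i, ‖a i‖ = 1)
    (hrq : (n : ℝ) ^ 2 * frameConst a 2 + ((n : ℝ) ^ 2 + n) * frameConst a n ≤ 1 / 6)
    {p : Fin K × ℤˣ} {x : Vec D} (hx : ‖x‖ = 1)
    (hxp : capCos n ≤ ⟪x, signedVec a p⟫) :
    spmObjective B x ≤ 1 - 9 / 16 * n * (1 - ⟪x, signedVec a p⟫ ^ 2)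
      + subspaceDist (powerSpan n a) B := by
  have h1 := spmObjective_powerSpan_le_of_close hn ha hrq hx (close_of_capCos_le hn hxp)
  have h2 := (abs_le.1 (abs_spmObjective_sub_le (powerSpan n a) B hx)).1
  rw [inner_signedVec_sq]
  linarith

/-- Each cap contains a critical point in its interior, of value at least the value at the center
of the cap: the values on the boundary of the cap are smaller. -/
lemma exists_critical_mem_cap (hn : 2 ≤ n) (ha : ∀ i, ‖a i‖ = 1)
    (hrq : (n : ℝ) ^ 2 * frameConst a 2 + ((n : ℝ) ^ 2 + n) * frameConst a n ≤ 1 / 6)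
    (hΔ : 9 * (n : ℝ) ^ 2 * subspaceDist (powerSpan n a) B ≤ 1)
    (p : Fin K × ℤˣ) :
    ∃ x : Vec D, IsSecondOrderCritical (spmObjective B) x ∧ capCos n < ⟪x, signedVec a p⟫ ∧
      1 - subspaceDist (powerSpan n a) B ^ 2 ≤ spmObjective B x := by
  set b := signedVec a p with hb
  have hb1 : ‖b‖ = 1 := norm_signedVec ha p
  have hn' : (2 : ℝ) ≤ n := by exact_mod_cast hn
  have hbb : capCos n ≤ ⟪b, b⟫ := by
    rw [real_inner_self_eq_norm_sq, hb1, one_pow]; exact capCos_le_one n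
  have hcompact : IsCompact (Metric.sphere (0 : Vec D) 1 ∩ {y | capCos n ≤ ⟪y, b⟫}) :=
    (isCompact_sphere 0 1).inter_right (isClosed_le continuous_const (by fun_prop))
  obtain ⟨x, ⟨hx1, hxb⟩, hmax⟩ := hcompact.exists_isMaxOn
    ⟨b, by simpa using hb1, hbb⟩ (contDiff_spmObjective B).continuous.continuousOn
  have hx1 : ‖x‖ = 1 := by simpa using hx1
  have hval : 1 - subspaceDist (powerSpan n a) B ^ 2 ≤ spmObjective B x :=
    (one_sub_sq_le_spmObjective _ B hb1 (tensorPower_signedVec_mem p)).trans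
      (hmax ⟨by simpa using hb1, hbb⟩)
  have hΔ0 := subspaceDist_nonneg (powerSpan n a) B
  -- On the boundary the quadratic decay is `(9/16) n / (3 n²) = 3 / (16 n)`, more than the loss
  -- `Δ + Δ²`, which is of order `1 / (9 n²)`.
  have hlt : capCos n < ⟪x, b⟫ := by
    refine lt_of_le_of_ne hxb fun h => ?_
    have h1 := spmObjective_le_of_mem_cap (B := B) hn ha hrq hx1 hxb
    rw [← hb, ← h] at h1
    have h2 := mul_one_sub_capCos_sq hn
    have h3 : 3 / 16 ≤ n * (subspaceDist (powerSpan n a) B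
        + subspaceDist (powerSpan n a) B ^ 2) := by nlinarith
    set Δ := subspaceDist (powerSpan n a) B
    have h4 : Δ ≤ 1 / 36 := by nlinarith [show (4 : ℝ) ≤ (n : ℝ) ^ 2 by nlinarith]
    have h5 : n * Δ ≤ 1 / 18 := by nlinarith
    nlinarith
  refine ⟨x, isSecondOrderCritical_of_isLocalMax (contDiff_spmObjective B) hx1
    (sub_pos.2 hlt) fun y hy hyx => ?_, hlt, hval⟩
  refine hmax ⟨by simpa using hy, ?_⟩
  have h1 := abs_real_inner_le_norm (x - y) b
  rw [hb1, mul_one, inner_sub_left, ← dist_eq_norm, dist_comm] at h1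
  have := (abs_le.1 h1).2
  show capCos n ≤ ⟪y, b⟫
  linarith

/-- The maximizer over a cap is close to the center of the cap. -/
lemma norm_sub_signedVec_sq_le (hn : 2 ≤ n) (ha : ∀ i, ‖a i‖ = 1)
    (hrq : (n : ℝ) ^ 2 * frameConst a 2 + ((n : ℝ) ^ 2 + n) * frameConst a n ≤ 1 / 6)
    (hΔ : 9 * (n : ℝ) ^ 2 * subspaceDist (powerSpan n a) B ≤ 1)
    {p : Fin K × ℤˣ} {x : Vec D} (hx : ‖x‖ = 1)
    (hxp : capCos n ≤ ⟪x, signedVec a p⟫)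
    (hval : 1 - subspaceDist (powerSpan n a) B ^ 2 ≤ spmObjective B x) :
    ‖x - signedVec a p‖ ^ 2 ≤ 2 * subspaceDist (powerSpan n a) B / n := by
  have hn' : (2 : ℝ) ≤ n := by exact_mod_cast hn
  have h1 := spmObjective_le_of_mem_cap (B := B) hn ha hrq hx hxp
  have hκ := le_capCos hn
  have hΔ0 := subspaceDist_nonneg (powerSpan n a) B
  have hle : ⟪x, signedVec a p⟫ ≤ 1 := by
    have := real_inner_le_norm x (signedVec a p)
    rwa [hx, norm_signedVec ha p, mul_one] at this
  rw [norm_sub_sq_real, hx, norm_signedVec ha p, le_div_iff₀ (by linarith)]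
  set Δ := subspaceDist (powerSpan n a) B
  set c := ⟪x, signedVec a p⟫
  have h4 : Δ ≤ 1 / 36 := by nlinarith [show (4 : ℝ) ≤ (n : ℝ) ^ 2 by nlinarith]
  have h5 : 9 / 16 * (n * (1 - c)) * (39 / 20) ≤ Δ * (37 / 36) := by
    have e1 : 0 ≤ n * (1 - c) := mul_nonneg (by linarith) (by linarith)
    nlinarith
  nlinarith

/-- The converse of `norm_sub_signedVec_sq_le`: near the center means inside the cap. -/
lemma capCos_le_of_norm_sub_sq_le (hn : 2 ≤ n) (ha : ∀ i, ‖a i‖ = 1)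
    {p : Fin K × ℤˣ} {x : Vec D} (hx : ‖x‖ = 1)
    (hΔ : 9 * (n : ℝ) ^ 2 * subspaceDist (powerSpan n a) B ≤ 1)
    (h : ‖x - signedVec a p‖ ^ 2 ≤ 2 * subspaceDist (powerSpan n a) B / n) :
    capCos n ≤ ⟪x, signedVec a p⟫ := by
  have hn' : (2 : ℝ) ≤ n := by exact_mod_cast hn
  rw [norm_sub_sq_real, hx, norm_signedVec ha p, le_div_iff₀ (by linarith)] at h
  have hκ := mul_one_sub_capCos_sq hn
  have hκ' := le_capCos hn
  have hΔ0 := subspaceDist_nonneg (powerSpan n a) B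
  set Δ := subspaceDist (powerSpan n a) B
  set c := ⟪x, signedVec a p⟫
  by_contra! hlt
  have h1 : 1 - c ≤ Δ / 2 := by nlinarith
  have h2 : 1 - capCos n ^ 2 ≤ 2 * (1 - capCos n) := by nlinarith [sq_nonneg (1 - capCos n)]
  nlinarith [show (0 : ℝ) < (n : ℝ) ^ 2 by positivity]

end Components

/-! ### Counting the critical points -/

section Counting

variable {D K n : ℕ} {a : Fin K → Vec D} {B : Submodule ℝ (Tens D n)}

lemma encard_range_of_injective {α : Type*} {f : Fin K × ℤˣ → α} (hf : Function.Injective f) :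
    (Set.range f).encard = ((2 * K : ℕ) : ℕ∞) := by
  rw [← Set.image_univ, hf.encard_image, Set.encard_univ, ENat.card_eq_coe_fintype_card,
    Fintype.card_prod, Fintype.card_fin, Fintype.card_units_int, mul_comm]

/-- A second-order critical point of positive value lies in a cap as soon as `Δ / F` is small. -/
lemma IsSecondOrderCritical.exists_capCos_le (hK : 0 < K) (hn : 2 ≤ n) (ha : ∀ i, ‖a i‖ = 1)
    (hrq : (n : ℝ) ^ 2 * frameConst a 2 + ((n : ℝ) ^ 2 + n) * frameConst a n ≤ 1 / 6)
    {x : Vec D} (hx : IsSecondOrderCritical (spmObjective B) x) (hpos : 0 < spmObjective B x)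
    (hF : 3 * (n : ℝ) ^ 2 * subspaceDist (powerSpan n a) B
      ≤ 2 * (1 / 6 - (n : ℝ) ^ 2 * (frameConst a 2 + frameConst a n)) * spmObjective B x) :
    ∃ p : Fin K × ℤˣ, capCos n ≤ ⟪x, signedVec a p⟫ := by
  have hr0 := frameConst_nonneg ha 2 ⟨0, hK⟩
  have hq0 := frameConst_nonneg ha n ⟨0, hK⟩
  have hn' : (2 : ℝ) ≤ n := by exact_mod_cast hn
  have hN2 : (4 : ℝ) ≤ (n : ℝ) ^ 2 := by nlinarith
  obtain ⟨i, hi⟩ := hx.exists_close hK hn ha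
    (by nlinarith [mul_nonneg (show 0 ≤ (n : ℝ) ^ 2 + n by positivity) hq0])
    (by nlinarith [mul_nonneg (show 0 ≤ (n : ℝ) ^ 2 by positivity) hr0])
  obtain ⟨s, hs⟩ := exists_sign_inner_eq_abs (a := a) x i
  refine ⟨(i, s), ?_⟩
  rw [hs]
  have h1 := mul_le_mul_of_nonneg_left hi (show 0 ≤ 3 * (n : ℝ) ^ 2 by positivity)
  have h2 : spmObjective B x * (3 * (n : ℝ) ^ 2 * (1 - ⟪x, a i⟫ ^ 2)) ≤ spmObjective B x * 1 := by
    linarith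
  have h3 := le_of_mul_le_mul_left h2 hpos
  have h4 := le_of_mul_le_mul_left (h3.trans_eq (mul_one_sub_capCos_sq hn).symm)
    (show 0 < 3 * (n : ℝ) ^ 2 by positivity)
  refine (sq_le_sq₀ (Real.sqrt_nonneg _) (abs_nonneg _)).1 ?_
  change capCos n ^ 2 ≤ _
  rw [sq_abs]
  linarith

/-- A critical point in the interior of a cap is a strict local maximizer on the sphere. -/
lemma isStrictLocalMaxOnSphere_of_mem_cap (hn : 2 ≤ n) (ha : ∀ i, ‖a i‖ = 1)
    (hrq : (n : ℝ) ^ 2 * frameConst a 2 + ((n : ℝ) ^ 2 + n) * frameConst a n ≤ 1 / 6)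
    (hΔ : 9 * (n : ℝ) ^ 2 * subspaceDist (powerSpan n a) B ≤ 1)
    {p : Fin K × ℤˣ} {x : Vec D} (hx : IsSecondOrderCritical (spmObjective B) x)
    (hxp : capCos n < ⟪x, signedVec a p⟫) : IsStrictLocalMaxOnSphere (spmObjective B) x := by
  refine ⟨hx.1, _, sub_pos.2 hxp, fun y hy hne hyx => ?_⟩
  refine lt_of_critical_of_mem_cap hn ha hrq hΔ hx.1 hxp.le hx.2.1 hy ?_ hne
  have h1 := abs_real_inner_le_norm (x - y) (signedVec a p)
  rw [norm_signedVec ha p, mul_one, inner_sub_left, ← dist_eq_norm, dist_comm] at h1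
  linarith [(abs_le.1 h1).2]

/-- Two critical points in the same cap coincide. -/
lemma eq_of_critical_of_mem_cap (hn : 2 ≤ n) (ha : ∀ i, ‖a i‖ = 1)
    (hrq : (n : ℝ) ^ 2 * frameConst a 2 + ((n : ℝ) ^ 2 + n) * frameConst a n ≤ 1 / 6)
    (hΔ : 9 * (n : ℝ) ^ 2 * subspaceDist (powerSpan n a) B ≤ 1)
    {p : Fin K × ℤˣ} {x y : Vec D} (hx : IsSecondOrderCritical (spmObjective B) x)
    (hxp : capCos n ≤ ⟪x, signedVec a p⟫) (hy : IsSecondOrderCritical (spmObjective B) y)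
    (hyp : capCos n ≤ ⟪y, signedVec a p⟫) : x = y := by
  by_contra hne
  have h1 := lt_of_critical_of_mem_cap hn ha hrq hΔ hx.1 hxp hx.2.1 hy.1 hyp (Ne.symm hne)
  have h2 := lt_of_critical_of_mem_cap hn ha hrq hΔ hy.1 hyp hy.2.1 hx.1 hxp hne
  exact lt_asymm h1 h2

end Counting

theorem theorem1 (D K n : ℕ) (hK : 0 < K) (hn : 2 ≤ n) (a : Fin K → Vec D)
    (ha : ∀ i, ‖a i‖ = 1) :
    (∀ Ahat : Submodule ℝ (Tens D n), Ahat ≤ symTens D n →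
      0 < tauConst n a →
      subspaceDist (powerSpan n a) Ahat
          < 2 * tauConst n a / (2 + 4 * tauConst n a + 3 * (n : ℝ) ^ 2) →
      {x : Vec D | IsSecondOrderCritical (spmObjective Ahat) x ∧ 0 < spmObjective Ahat x ∧
          (2 + 2 * tauConst n a + 3 * (n : ℝ) ^ 2) / (2 * tauConst n a)
              * subspaceDist (powerSpan n a) Ahat ≤ spmObjective Ahat x}.encard
        = ((2 * K : ℕ) : ℕ∞) ∧
      ∀ x : Vec D, IsSecondOrderCritical (spmObjective Ahat) x → 0 < spmObjective Ahat x →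
        (2 + 2 * tauConst n a + 3 * (n : ℝ) ^ 2) / (2 * tauConst n a)
            * subspaceDist (powerSpan n a) Ahat ≤ spmObjective Ahat x →
        IsStrictLocalMaxOnSphere (spmObjective Ahat) x ∧
        ∃! p : Fin K × ℤˣ,
          ‖x - ((p.2 : ℤ) : ℝ) • a p.1‖ ^ 2
            ≤ 2 * subspaceDist (powerSpan n a) Ahat / (n : ℝ)) ∧
    (0 ≤ tauConst n a →
      {x : Vec D | IsSecondOrderCritical (spmObjective (powerSpan n a)) x ∧
          0 < spmObjective (powerSpan n a) x}.encard = ((2 * K : ℕ) : ℕ∞) ∧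
      {x : Vec D | IsSecondOrderCritical (spmObjective (powerSpan n a)) x ∧
          0 < spmObjective (powerSpan n a) x}
        = {x : Vec D | ∃ (i : Fin K) (s : ℤˣ), x = ((s : ℤ) : ℝ) • a i} ∧
      {x : Vec D | ∃ (i : Fin K) (s : ℤˣ), x = ((s : ℤ) : ℝ) • a i}
        = {x : Vec D | ‖x‖ = 1 ∧ ∀ y : Vec D, ‖y‖ = 1 →
            spmObjective (powerSpan n a) y ≤ spmObjective (powerSpan n a) x}) := by
  have hn' : (2 : ℝ) ≤ n := by exact_mod_cast hn
  have hr0 := frameConst_nonneg ha 2 ⟨0, hK⟩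
  have hq0 := frameConst_nonneg ha n ⟨0, hK⟩
  have hτ_eq : tauConst n a = 1 / 6 - (n : ℝ) ^ 2 * frameConst a 2
      - ((n : ℝ) ^ 2 + n) * frameConst a n := rfl
  have hτ_le : tauConst n a ≤ 1 / 6 - (n : ℝ) ^ 2 * (frameConst a 2 + frameConst a n) := by
    rw [hτ_eq]
    nlinarith [mul_nonneg (show (0 : ℝ) ≤ n by linarith) hq0]
  have hr_le : 0 ≤ tauConst n a → frameConst a 2 ≤ 1 / 24 := by
    intro h
    nlinarith [mul_nonneg (show 0 ≤ (n : ℝ) ^ 2 by positivity) hq0,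
      mul_nonneg (show 0 ≤ (n : ℝ) ^ 2 - 4 by nlinarith) hr0]
  refine ⟨fun B _ hτ hdist => ?_, fun hτ => ?_⟩
  · have hrq : (n : ℝ) ^ 2 * frameConst a 2 + ((n : ℝ) ^ 2 + n) * frameConst a n ≤ 1 / 6 := by
      linarith
    have hΔ0 := subspaceDist_nonneg (powerSpan n a) B
    have hr := hr_le hτ.le
    have hτ6 : tauConst n a ≤ 1 / 6 := by
      nlinarith [mul_nonneg (show 0 ≤ (n : ℝ) ^ 2 by positivity) (add_nonneg hr0 hq0)]
    rw [lt_div_iff₀ (by positivity)] at hdist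
    have hΔ : 9 * (n : ℝ) ^ 2 * subspaceDist (powerSpan n a) B ≤ 1 := by
      nlinarith [mul_nonneg hΔ0 hτ.le]
    have hthr : ∀ x, 1 - subspaceDist (powerSpan n a) B ^ 2 ≤ spmObjective B x →
        0 < spmObjective B x ∧ (2 + 2 * tauConst n a + 3 * (n : ℝ) ^ 2) / (2 * tauConst n a)
          * subspaceDist (powerSpan n a) B ≤ spmObjective B x := by
      intro x hx
      have hΔ1 : subspaceDist (powerSpan n a) B ≤ 1 / 36 := by nlinarith
      refine ⟨by nlinarith, le_trans ?_ hx⟩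
      rw [div_mul_eq_mul_div, div_le_iff₀ (by positivity)]
      have : 1 - subspaceDist (powerSpan n a) B ≤ 1 - subspaceDist (powerSpan n a) B ^ 2 := by
        nlinarith
      nlinarith [mul_le_mul_of_nonneg_left this hτ.le]
    have hloc : ∀ x, IsSecondOrderCritical (spmObjective B) x → 0 < spmObjective B x →
        (2 + 2 * tauConst n a + 3 * (n : ℝ) ^ 2) / (2 * tauConst n a)
          * subspaceDist (powerSpan n a) B ≤ spmObjective B x →
        ∃ p : Fin K × ℤˣ, capCos n ≤ ⟪x, signedVec a p⟫ := by
      intro x hx hpos hF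
      refine hx.exists_capCos_le hK hn ha hrq hpos ?_
      rw [div_mul_eq_mul_div, div_le_iff₀ (by positivity)] at hF
      nlinarith [mul_nonneg hΔ0 hτ.le, mul_le_mul_of_nonneg_right hτ_le hpos.le]
    choose X hXcrit hXcap hXval using fun p => exists_critical_mem_cap hn ha hrq hΔ p
    have huniq : ∀ x, IsSecondOrderCritical (spmObjective B) x → ∀ p : Fin K × ℤˣ,
        capCos n ≤ ⟪x, signedVec a p⟫ → x = X p := fun x hx p hp =>
      eq_of_critical_of_mem_cap hn ha hrq hΔ hx hp (hXcrit p) (hXcap p).le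
    refine ⟨?_, fun x hx hpos hF => ?_⟩
    · rw [← encard_range_of_injective (f := X) fun p p' h =>
        eq_of_mem_caps hn ha hr (hXcrit p).1 (hXcap p).le (h ▸ (hXcap p').le)]
      congr 1
      ext x
      constructor
      · rintro ⟨hx, hpos, hF⟩
        obtain ⟨p, hp⟩ := hloc x hx hpos hF
        exact ⟨p, (huniq x hx p hp).symm⟩
      · rintro ⟨p, rfl⟩
        exact ⟨hXcrit p, hthr _ (hXval p)⟩
    · obtain ⟨p, hp⟩ := hloc x hx hpos hF
      obtain rfl := huniq x hx p hp
      refine ⟨isStrictLocalMaxOnSphere_of_mem_cap hn ha hrq hΔ hx (hXcap p), p,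
        norm_sub_signedVec_sq_le hn ha hrq hΔ hx.1 hp (hXval p), fun p' hp' => ?_⟩
      exact eq_of_mem_caps hn ha hr hx.1
        (capCos_le_of_norm_sub_sq_le hn ha hx.1 hΔ hp') hp
  · have hrq : (n : ℝ) ^ 2 * frameConst a 2 + ((n : ℝ) ^ 2 + n) * frameConst a n ≤ 1 / 6 := by
      linarith
    have hr := hr_le hτ
    have hΔ0 : subspaceDist (powerSpan n a) (powerSpan n a) = 0 := by simp [subspaceDist]
    have hΔ : 9 * (n : ℝ) ^ 2 * subspaceDist (powerSpan n a) (powerSpan n a) ≤ 1 := by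
      rw [hΔ0]; norm_num
    have hF1 : ∀ y : Vec D, ‖y‖ = 1 → spmObjective (powerSpan n a) y ≤ 1 := by
      intro y hy
      have := (powerSpan n a).norm_starProjection_apply_le (tensorPower n y)
      rw [norm_tensorPower hy] at this
      exact pow_le_one₀ (norm_nonneg _) this
    -- With `Δ = 0` the critical point in the cap is its center.
    have hcenter : ∀ p : Fin K × ℤˣ,
        IsSecondOrderCritical (spmObjective (powerSpan n a)) (signedVec a p) ∧
          1 ≤ spmObjective (powerSpan n a) (signedVec a p) := by
      intro p
      obtain ⟨x, hx, hxp, hval⟩ := exists_critical_mem_cap hn ha hrq hΔ p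
      have h := norm_sub_signedVec_sq_le hn ha hrq hΔ hx.1 hxp.le hval
      rw [hΔ0] at h hval
      rw [mul_zero, zero_div] at h
      have : x = signedVec a p := by
        rw [← sub_eq_zero, ← norm_eq_zero]
        exact pow_eq_zero_iff two_ne_zero |>.1 (le_antisymm h (sq_nonneg _))
      rw [this] at hx hval
      exact ⟨hx, by simpa using hval⟩
    have hcap : ∀ p : Fin K × ℤˣ, capCos n ≤ ⟪signedVec a p, signedVec a p⟫ := by
      intro p
      rw [real_inner_self_eq_norm_sq, norm_signedVec ha, one_pow]
      exact capCos_le_one n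
    have hrange : {x : Vec D | ∃ (i : Fin K) (s : ℤˣ), x = ((s : ℤ) : ℝ) • a i}
        = Set.range (signedVec a) := by
      ext x
      constructor
      · rintro ⟨i, s, rfl⟩
        exact ⟨(i, s), rfl⟩
      · rintro ⟨p, rfl⟩
        exact ⟨p.1, p.2, rfl⟩
    have hset : {x : Vec D | IsSecondOrderCritical (spmObjective (powerSpan n a)) x ∧
        0 < spmObjective (powerSpan n a) x} = Set.range (signedVec a) := by
      ext x
      constructor
      · rintro ⟨hx, hpos⟩
        obtain ⟨p, hp⟩ := hx.exists_capCos_le hK hn ha hrq hpos (by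
          rw [hΔ0, mul_zero]
          exact mul_nonneg (by linarith) hpos.le)
        exact ⟨p, eq_of_critical_of_mem_cap hn ha hrq hΔ (hcenter p).1 (hcap p) hx hp⟩
      · rintro ⟨p, rfl⟩
        exact ⟨(hcenter p).1, by linarith [(hcenter p).2]⟩
    refine ⟨?_, hset.trans hrange.symm, ?_⟩
    · rw [hset]
      exact encard_range_of_injective fun p p' h =>
        eq_of_mem_caps hn ha hr (norm_signedVec ha p) (hcap p) (h ▸ hcap p')
    · rw [hrange]
      ext x
      constructor
      · rintro ⟨p, rfl⟩
        exact ⟨norm_signedVec ha p, fun y hy => (hF1 y hy).trans (hcenter p).2⟩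
      · rintro ⟨hx, hmax⟩
        rw [← hset]
        refine ⟨isSecondOrderCritical_of_isLocalMax (contDiff_spmObjective _) hx one_pos
          fun y hy _ => hmax y hy, ?_⟩
        linarith [hmax _ (norm_signedVec ha (⟨0, hK⟩, 1)), (hcenter (⟨0, hK⟩, 1)).2]
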